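/- Let $A\in\mathbb{R}^{m\times n}$ with $\operatorname{rank}A=m$ and let $b\in\mathbb{R}^m\setminus\{0\}$ (so $b\in\operatorname{Im}A$). For $t>0$, a primal solution at hyperparameter $t$ is a minimizer $x\in\mathbb{R}^n$ of $\|x\|_1+\frac{1}{2t}\|Ax-b\|_2^2$ (basis pursuit denoising); for $t=0$ it is a minimizer of $\|x\|_1$ subject to $Ax=b$ (basis pursuit). For $t\ge 0$, a dual solution at $t$ is a minimizer $p\in\mathbb{R}^m$ of $\frac t2\|p\|_2^2+\langle p,b\rangle$ subject to $\|-A^{\top}p\|_\infty\le 1$. For $p\in\mathbb{R}^m$ put $\mathcal E(p)=\{j: |(-A^{\top}p)_j|=1\}$ and $D(p)=\operatorname{diag}(\operatorname{sgn}(-A^{\top}p))$, with the convention $\operatorname{sgn}(0)=1$. The homotopy algorithm starts with $t^{(0)}=\|A^{\top}b\|_\infty$, $x^{(0)}=0$, $p^{(0)}=-b/\|A^{\top}b\|_\infty$. For $k=1,2,\dots$, as long as $t^{(k-1)}\neq 0$, write $(t_0,x,p)=(t^{(k-1)},x^{(k-1)},p^{(k-1)})$, $\mathcal E=\mathcal E(p)$,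 $D=D(p)$, and: 1. let $\hat v^{(k-1)}=\hat v$ be the element of minimal $\ell_2$ norm of $$\operatorname*{arg\,min}\left\{\|ADv+t_0p\|_2^2 : v\in\mathbb{R}^n,\ v_j\ge 0 \text{ if } j\in\mathcal E,\ x_j=0;\ v_j=0\text{ if }j\notin\mathcal E\right\};$$ 2. let $\xi^{(k-1)}=\xi=AD\hat v+t_0p$ and $$C=\min_{1\le j\le n}\frac{\operatorname{sgn}((DA^{\top}\xi)_j)-(DA^{\top}p)_j}{(DA^{\top}\xi)_j}\in(-\infty,+\infty],$$ a quotient with zero denominator being $+\infty$; 3. let $T_+=\dfrac{t_0}{1+t_0C}$ (equal to $0$ if $C=+\infty$) and $T_-=t_0\Bigl(1-\inf\bigl\{|x_j|/|\hat v_j| : j\in\mathcal E,\ x_j\ne 0,\ \hat v_j\le -|x_j|\bigr\}\Bigr)$, with $\inf\varnothing=+\infty$ (so that then $T_-=-\infty$), and $t^{(k)}=\max(T_-,T_+)$; 4. let $x^{(k)}=x+(1-t^{(k)}/t_0)D\hat v$; let $p^{(k)}=p$ if $t^{(k)}=0$, in which case the algorithm stops, and $p^{(k)}=p+(1/t^{(k)}-1/t_0)\xi$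 otherwise. Then the algorithm is correct and terminates after finitely many steps: there is a nonnegative integer $K$ with $t^{(K)}=0$ such that (a) for every $0\le k\le K$, $x^{(k)}$ is a primal solution and $p^{(k)}$ is a dual solution at hyperparameter $t^{(k)}$ (in particular $x^{(K)}$ solves basis pursuit and $p^{(K)}$ solves its dual); (b) for every $1\le k\le K$, the minimal-norm solution $\hat v^{(k-1)}$ exists and is unique, $0\le t^{(k)}<t^{(k-1)}$, and for every $t\in[t^{(k)},t^{(k-1)}]$ the vector $x^{(k-1)}+(1-t/t^{(k-1)})D(p^{(k-1)})\hat v^{(k-1)}$ is a primal solution and the vector $p^{(k-1)}+(1/t-1/t^{(k-1)})\xi^{(k-1)}$ (respectively $p^{(k-1)}$ if $t^{(k)}=0$) is a dual solution at hyperparameter $t$. -/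

import Mathlib

open scoped Matrix

namespace BPDN

/-- The sign of a real number, with value `1` at `0`, so that a matrix of signs has no zero on its
diagonal. -/
noncomputable def sgn (r : ℝ) : ℝ := if 0 ≤ r then 1 else -1

/-- The squared Euclidean norm. -/
def sqNorm {k : ℕ} (y : Fin k → ℝ) : ℝ := ∑ i, y i ^ 2

/-- The `ℓ₁` norm. -/
def l1Norm {k : ℕ} (y : Fin k → ℝ) : ℝ := ∑ i, |y i|

/-- `x` solves basis pursuit denoising at hyperparameter `t > 0`, that is, it minimizes
`‖x‖₁ + ‖A x - b‖₂² / (2 t)`; for `t = 0`, `x` solves basis pursuit, that is, it minimizes `‖x‖₁`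
subject to `A x = b`. -/
def IsPrimalSolution {m n : ℕ} (A : Matrix (Fin m) (Fin n) ℝ) (b : Fin m → ℝ) (t : ℝ)
    (x : Fin n → ℝ) : Prop :=
  if t = 0 then
    A *ᵥ x = b ∧ ∀ z : Fin n → ℝ, A *ᵥ z = b → l1Norm x ≤ l1Norm z
  else
    ∀ z : Fin n → ℝ, l1Norm x + 1 / (2 * t) * sqNorm (A *ᵥ x - b) ≤
      l1Norm z + 1 / (2 * t) * sqNorm (A *ᵥ z - b)

/-- `p` solves the dual problem: it minimizes `(t / 2) ‖p‖₂² + ⟨p, b⟩` subject to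
`‖-Aᵀ p‖_∞ ≤ 1` (the norm of `Fin n → ℝ` is the sup norm). For `t = 0` this is the dual of basis
pursuit. -/
def IsDualSolution {m n : ℕ} (A : Matrix (Fin m) (Fin n) ℝ) (b : Fin m → ℝ) (t : ℝ)
    (p : Fin m → ℝ) : Prop :=
  ‖-(Aᵀ *ᵥ p)‖ ≤ 1 ∧ ∀ q : Fin m → ℝ, ‖-(Aᵀ *ᵥ q)‖ ≤ 1 →
    t / 2 * sqNorm p + p ⬝ᵥ b ≤ t / 2 * sqNorm q + q ⬝ᵥ b

/-- The equicorrelation set at `p`. -/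
def equicorrelationSet {m n : ℕ} (A : Matrix (Fin m) (Fin n) ℝ) (p : Fin m → ℝ) : Set (Fin n) :=
  {j | |(-(Aᵀ *ᵥ p)) j| = 1}

/-- The diagonal matrix of signs `D(p) = diag (sgn (-Aᵀ p))`. -/
noncomputable def signMatrix {m n : ℕ} (A : Matrix (Fin m) (Fin n) ℝ) (p : Fin m → ℝ) :
    Matrix (Fin n) (Fin n) ℝ :=
  Matrix.diagonal fun j => sgn ((-(Aᵀ *ᵥ p)) j)

/-- The data carried from one iteration of the homotopy algorithm to the next. -/
structure State (m n : ℕ) where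
  /-- current hyperparameter -/
  t : ℝ
  /-- current primal vector -/
  x : Fin n → ℝ
  /-- current dual vector -/
  p : Fin m → ℝ

/-- The residual vector `A D(p) v + t p`. -/
noncomputable def residual {m n : ℕ} (A : Matrix (Fin m) (Fin n) ℝ) (s : State m n)
    (v : Fin n → ℝ) : Fin m → ℝ :=
  (A * signMatrix A s.p) *ᵥ v + s.t • s.p

/-- The constraints of the nonnegative least-squares problem of an iteration. -/
def NNLSFeasible {m n : ℕ} (A : Matrix (Fin m) (Fin n) ℝ) (s : State m n)
    (v : Fin n → ℝ) : Prop :=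
  (∀ j, j ∈ equicorrelationSet A s.p → s.x j = 0 → 0 ≤ v j) ∧
    ∀ j, j ∉ equicorrelationSet A s.p → v j = 0

/-- `v` solves the nonnegative least-squares problem: minimize `‖A D(p) v + t p‖₂²` subject to the
constraints above. -/
def IsNNLSSolution {m n : ℕ} (A : Matrix (Fin m) (Fin n) ℝ) (s : State m n)
    (v : Fin n → ℝ) : Prop :=
  NNLSFeasible A s v ∧ ∀ w, NNLSFeasible A s w →
    sqNorm (residual A s v) ≤ sqNorm (residual A s w)

/-- `v` is a nonnegative least-squares solution of minimal `ℓ₂` norm. -/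
def IsMinNormNNLSSolution {m n : ℕ} (A : Matrix (Fin m) (Fin n) ℝ) (s : State m n)
    (v : Fin n → ℝ) : Prop :=
  IsNNLSSolution A s v ∧ ∀ w, IsNNLSSolution A s w → sqNorm v ≤ sqNorm w

/-- The nonnegative least-squares solution of minimal `ℓ₂` norm used by the iteration. -/
noncomputable def vHat {m n : ℕ} (A : Matrix (Fin m) (Fin n) ℝ) (s : State m n) : Fin n → ℝ :=
  Classical.epsilon fun v => IsMinNormNNLSSolution A s v

/-- The residual `ξ` at the selected nonnegative least-squares solution. -/
noncomputable def xi {m n : ℕ} (A : Matrix (Fin m) (Fin n) ℝ) (s : State m n) : Fin m → ℝ :=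
  residual A s (vHat A s)

/-- The number `C`: the smallest over `j` of
`(sgn (D Aᵀ ξ)_j - (D Aᵀ p)_j) / (D Aᵀ ξ)_j`, where a quotient with zero denominator is `+∞`. -/
noncomputable def cHat {m n : ℕ} (A : Matrix (Fin m) (Fin n) ℝ) (s : State m n) : EReal :=
  ⨅ j : Fin n,
    if ((signMatrix A s.p * Aᵀ) *ᵥ xi A s) j = 0 then ⊤
    else (((sgn (((signMatrix A s.p * Aᵀ) *ᵥ xi A s) j) - ((signMatrix A s.p * Aᵀ) *ᵥ s.p) j) /
      ((signMatrix A s.p * Aᵀ) *ᵥ xi A s) j : ℝ) : EReal)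

/-- The breakpoint `T₊ = t / (1 + t C)`, equal to `0` when `C = +∞`. -/
noncomputable def tPlus {m n : ℕ} (A : Matrix (Fin m) (Fin n) ℝ) (s : State m n) : EReal :=
  (s.t : EReal) / (1 + (s.t : EReal) * cHat A s)

/-- The breakpoint `T₋ = t (1 - inf |x_j| / |v_j|)`, equal to `-∞` when the infimum is over the
empty set. -/
noncomputable def tMinus {m n : ℕ} (A : Matrix (Fin m) (Fin n) ℝ) (s : State m n) : EReal :=
  (s.t : EReal) * (1 - ⨅ j : Fin n,
    ⨅ _ : j ∈ equicorrelationSet A s.p ∧ s.x j ≠ 0 ∧ vHat A s j ≤ -|s.x j|,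
      ((|s.x j| / |vHat A s j| : ℝ) : EReal))

/-- The next hyperparameter `max (T₋, T₊)`. -/
noncomputable def nextT {m n : ℕ} (A : Matrix (Fin m) (Fin n) ℝ) (s : State m n) : ℝ :=
  (max (tMinus A s) (tPlus A s)).toReal

/-- The local continuation of the primal vector, at hyperparameter `τ`. -/
noncomputable def primalPath {m n : ℕ} (A : Matrix (Fin m) (Fin n) ℝ) (s : State m n) (τ : ℝ) :
    Fin n → ℝ :=
  s.x + (1 - τ / s.t) • (signMatrix A s.p *ᵥ vHat A s)

/-- The local continuation of the dual vector, at hyperparameter `τ`. -/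
noncomputable def dualPath {m n : ℕ} (A : Matrix (Fin m) (Fin n) ℝ) (s : State m n) (τ : ℝ) :
    Fin m → ℝ :=
  if nextT A s = 0 then s.p else s.p + (1 / τ - 1 / s.t) • xi A s

/-- The initialization of the homotopy algorithm. -/
noncomputable def initState {m n : ℕ} (A : Matrix (Fin m) (Fin n) ℝ) (b : Fin m → ℝ) :
    State m n where
  t := ‖Aᵀ *ᵥ b‖
  x := 0
  p := -((1 / ‖Aᵀ *ᵥ b‖) • b)

/-- One iteration of the homotopy algorithm; nothing is done once the hyperparameter is zero. -/
noncomputable def step {m n : ℕ} (A : Matrix (Fin m) (Fin n) ℝ) (s : State m n) : State m n :=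
  if s.t = 0 then s
  else
    { t := nextT A s
      x := primalPath A s (nextT A s)
      p := dualPath A s (nextT A s) }

/-- The state `(t⁽ᵏ⁾, x⁽ᵏ⁾, p⁽ᵏ⁾)` of the homotopy algorithm after `k` iterations. -/
noncomputable def iterate {m n : ℕ} (A : Matrix (Fin m) (Fin n) ℝ) (b : Fin m → ℝ) :
    ℕ → State m n
  | 0 => initState A b
  | k + 1 => step A (iterate A b k)

end BPDN

/-!
A pair `(x, p)` solves the primal and the dual problem at hyperparameter `t` as soon as
`t p = A x - b`, `‖Aᵀ p‖_∞ ≤ 1` and `-(Aᵀ p)_j x_j = |x_j|` for all `j` (`KKT`, which also covers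
`t = 0`). Each iteration preserves these conditions.

*Existence of the direction.* The image of the cone of feasible `v` under a matrix is closed
(`isClosed_image_supportCone`), so the nonnegative least-squares problem has a minimizer; its
solutions form a closed set stable under midpoints, which has exactly one element of least norm.

*Correctness of a step.* The first-order conditions of the least-squares problem say that the rate
of change `D Aᵀ ξ` of the signed correlations is nonnegative on the equicorrelation set and vanishes
wherever `x` or `v̂` does not (`corrRate_nonneg`, `corrRate_eq_zero`,
`corrRate_eq_zero_of_vHat_ne_zero`). Hence `C > 0`, the next hyperparameter is smaller than the
current one, and the path satisfies `KKT` until a dual constraint (`T₊`) or a sign constraint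
(`T₋`) blocks it (`nextT_spec`, `KKT.path_dualPath`). It reaches `0` only if `ξ = 0`, as `Aᵀ` is
injective.

*Termination.* Inside an iteration the dual path stays in the relative interior of one face of the
dual polytope (`facePattern`). Since the dual solution at `t > 0` is unique and `KKT` is convex in
`(1 / t, x / t, p)` along a face, the iterations belonging to one face are consecutive
(`KKT.facePattern_eq_of_between`). The face determines `ξ` and the image under `A` of the velocity
`g = D v̂ / t` of the primal path; given the zero set of `x` as well, `g` is the vector of least
norm in a fixed polyhedron. From one iteration to the next in the same face `‖g‖` increases strictly
(`Admissible.sqNorm_velocity_lt_step`): `g` remains optimal without the sign constraints that the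
path has left, and it violates the one that blocked it. So no pair of a face and a zero set occurs
twice, and there are finitely many such pairs.
-/

namespace BPDN

open scoped Topology

variable {m n : ℕ}

/-! ### The squared Euclidean norm -/

lemma sqNorm_eq_dotProduct (y : Fin n → ℝ) : sqNorm y = y ⬝ᵥ y := by
  simp [sqNorm, dotProduct, pow_two]

lemma sqNorm_nonneg (y : Fin n → ℝ) : 0 ≤ sqNorm y :=
  Finset.sum_nonneg fun _ _ => sq_nonneg _

lemma sqNorm_eq_zero {y : Fin n → ℝ} : sqNorm y = 0 ↔ y = 0 := by
  rw [sqNorm_eq_dotProduct, dotProduct_self_eq_zero]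

lemma sqNorm_add (x y : Fin n → ℝ) : sqNorm (x + y) = sqNorm x + 2 * (x ⬝ᵥ y) + sqNorm y := by
  simp only [sqNorm_eq_dotProduct, add_dotProduct, dotProduct_add, dotProduct_comm y x]
  ring

lemma sqNorm_smul (c : ℝ) (y : Fin n → ℝ) : sqNorm (c • y) = c ^ 2 * sqNorm y := by
  simp only [sqNorm_eq_dotProduct, smul_dotProduct, dotProduct_smul, smul_eq_mul]
  ring

lemma continuous_sqNorm : Continuous (sqNorm : (Fin n → ℝ) → ℝ) := by
  unfold sqNorm
  fun_prop

/-- The parallelogram identity at the midpoint. -/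
lemma sqNorm_midpoint (x y : Fin n → ℝ) :
    sqNorm ((1 / 2 : ℝ) • (x + y)) =
      (sqNorm x + sqNorm y) / 2 - sqNorm (x - y) / 4 := by
  rw [sqNorm_smul, show x - y = x + (-1 : ℝ) • y by module, sqNorm_add, sqNorm_add,
    dotProduct_smul, sqNorm_smul, smul_eq_mul]
  ring

lemma exists_sqNorm_add_le {S : Set (Fin n → ℝ)} (hS : IsClosed S) (hne : S.Nonempty)
    (c : Fin n → ℝ) : ∃ y ∈ S, ∀ z ∈ S, sqNorm (y + c) ≤ sqNorm (z + c) := by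
  let e := (EuclideanSpace.equiv (Fin n) ℝ)
  have hcl : IsClosed (e ⁻¹' S) := hS.preimage e.continuous
  have hne' : (e ⁻¹' S).Nonempty := by
    obtain ⟨y, hy⟩ := hne
    exact ⟨e.symm y, by simpa using hy⟩
  obtain ⟨y, hy, hd⟩ := hcl.exists_infDist_eq_dist hne' (e.symm (-c))
  have key : ∀ z : EuclideanSpace ℝ (Fin n), dist (e.symm (-c)) z ^ 2 = sqNorm (e z + c) := by
    intro z
    rw [EuclideanSpace.dist_eq, Real.sq_sqrt (Finset.sum_nonneg fun _ _ => sq_nonneg _)]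
    refine Finset.sum_congr rfl fun i _ => ?_
    rw [Real.dist_eq, sq_abs]
    change (-c i - z i) ^ 2 = (z i + c i) ^ 2
    ring
  refine ⟨e y, hy, fun z hz => ?_⟩
  have h1 : dist (e.symm (-c)) y ≤ dist (e.symm (-c)) (e.symm z) := by
    rw [← hd]
    exact Metric.infDist_le_dist_of_mem (by simpa using hz)
  have h2 := pow_le_pow_left₀ dist_nonneg h1 2
  rw [key, key] at h2
  simpa using h2

/-! ### Nonnegative least squares -/

/-- The vectors supported on `E` whose entries with index in `P` are nonnegative. -/
def supportCone (P : Set (Fin n)) (E : Finset (Fin n)) : Set (Fin n → ℝ) :=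
  {v | (∀ j ∈ E, j ∈ P → 0 ≤ v j) ∧ ∀ j ∉ E, v j = 0}

lemma supportCone_erase_subset (P : Set (Fin n)) (E : Finset (Fin n)) (j : Fin n) :
    supportCone P (E.erase j) ⊆ supportCone P E := by
  rintro v ⟨h1, h2⟩
  refine ⟨fun i hi hP => ?_, fun i hi => h2 i fun h => hi (Finset.mem_of_mem_erase h)⟩
  by_cases hij : i = j
  · exact (h2 i (by simp [hij])).ge
  · exact h1 i (Finset.mem_erase.2 ⟨hij, hi⟩) hP

lemma isClosed_supportCone (P : Set (Fin n)) (E : Finset (Fin n)) :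
    IsClosed (supportCone P E) := by
  have : supportCone P E = (⋂ j ∈ E, ⋂ _ : j ∈ P, {v : Fin n → ℝ | 0 ≤ v j}) ∩
      ⋂ j, ⋂ _ : j ∉ E, {v : Fin n → ℝ | v j = 0} := by
    ext v
    simp [supportCone]
  rw [this]
  refine IsClosed.inter ?_ ?_
  · exact isClosed_biInter fun j _ => isClosed_iInter fun _ =>
      isClosed_le continuous_const (continuous_apply j)
  · exact isClosed_iInter fun j => isClosed_iInter fun _ =>
      isClosed_eq (continuous_apply j) continuous_const

/-- Moving along a kernel vector supported on `E` until a coordinate vanishes removes an index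
from the support without changing the image. -/
lemma exists_mem_supportCone_erase (M : Matrix (Fin m) (Fin n) ℝ) (P : Set (Fin n))
    (E : Finset (Fin n)) {h : Fin n → ℝ} (hE : ∀ j ∉ E, h j = 0) (hM : M *ᵥ h = 0)
    (hne : h ≠ 0) {v : Fin n → ℝ} (hv : v ∈ supportCone P E) :
    ∃ j ∈ E, ∃ w ∈ supportCone P (E.erase j), M *ᵥ w = M *ᵥ v := by
  classical
  by_cases hP : ∃ j ∈ E, j ∈ P ∧ h j ≠ 0
  · -- After a change of sign, `h` decreases some constrained coordinate.
    obtain ⟨h', hE', hM', j₀, hj₀E, hj₀P, hj₀⟩ : ∃ h' : Fin n → ℝ, (∀ j ∉ E, h' j = 0) ∧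
        M *ᵥ h' = 0 ∧ ∃ j ∈ E, j ∈ P ∧ h' j < 0 := by
      obtain ⟨j, hjE, hjP, hj⟩ := hP
      rcases lt_or_gt_of_ne hj with hlt | hgt
      · exact ⟨h, hE, hM, j, hjE, hjP, hlt⟩
      · exact ⟨-h, fun i hi => by simp [hE i hi], by simp [Matrix.mulVec_neg, hM],
          j, hjE, hjP, by simpa using hgt⟩
    obtain ⟨j, hj, hmin⟩ := (E.filter fun j => j ∈ P ∧ h' j < 0).exists_min_image
      (fun j => v j / -h' j) ⟨j₀, by simp [*]⟩
    simp only [Finset.mem_filter] at hj hmin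
    obtain ⟨hjE, hjP, hjneg⟩ := hj
    have hs : 0 ≤ v j / -h' j := div_nonneg (hv.1 j hjE hjP) (by linarith)
    refine ⟨j, hjE, v + (v j / -h' j) • h', ⟨fun i hi hiP => ?_, fun i hi => ?_⟩, ?_⟩
    · have hiE := Finset.mem_of_mem_erase hi
      have hvi := hv.1 i hiE hiP
      simp only [Pi.add_apply, Pi.smul_apply, smul_eq_mul]
      rcases le_or_gt 0 (h' i) with hi0 | hi0
      · positivity
      · have := hmin i ⟨hiE, hiP, hi0⟩
        rw [le_div_iff₀ (by linarith)] at this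
        linarith
    · simp only [Pi.add_apply, Pi.smul_apply, smul_eq_mul]
      by_cases hij : i = j
      · subst hij
        have := hjneg.ne
        field_simp
        ring
      · have hiE : i ∉ E := fun h => hi (Finset.mem_erase.2 ⟨hij, h⟩)
        simp [hv.2 i hiE, hE' i hiE]
    · simp [Matrix.mulVec_add, Matrix.mulVec_smul, hM']
  · push Not at hP
    obtain ⟨j, hj⟩ := Function.ne_iff.1 hne
    have hj' : h j ≠ 0 := hj
    have hjE : j ∈ E := by
      by_contra hc
      exact hj' (hE j hc)
    refine ⟨j, hjE, v + (-v j / h j) • h, ⟨fun i hi hiP => ?_, fun i hi => ?_⟩, ?_⟩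
    · have hiE := Finset.mem_of_mem_erase hi
      simpa [hP i hiE hiP] using hv.1 i hiE hiP
    · simp only [Pi.add_apply, Pi.smul_apply, smul_eq_mul]
      by_cases hij : i = j
      · subst hij
        field_simp
        ring
      · have hiE : i ∉ E := fun h => hi (Finset.mem_erase.2 ⟨hij, h⟩)
        simp [hv.2 i hiE, hE i hiE]
    · simp [Matrix.mulVec_add, Matrix.mulVec_smul, hM]

/-- The image of a cone `supportCone P E` under a matrix is closed. If the matrix is injective on
the vectors supported on `E`, it is a closed embedding there; otherwise the image is the union of
the images of the cones with one index less. -/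
lemma isClosed_image_supportCone (M : Matrix (Fin m) (Fin n) ℝ) (P : Set (Fin n))
    (E : Finset (Fin n)) : IsClosed ((M *ᵥ ·) '' supportCone P E) := by
  classical
  induction E using Finset.strongInduction with
  | H E ih =>
    by_cases hker : ∀ h : Fin n → ℝ, (∀ j ∉ E, h j = 0) → M *ᵥ h = 0 → h = 0
    · -- Recording the coordinates outside `E` makes the map injective on the whole space.
      let T : (Fin n → ℝ) →ₗ[ℝ] (Fin m → ℝ) × (Fin n → ℝ) :=
        M.mulVecLin.prod (LinearMap.pi fun j => if j ∈ E then 0 else LinearMap.proj j)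
      have hT : ∀ v, T v = (M *ᵥ v, fun j => if j ∈ E then 0 else v j) := by
        intro v
        ext j
        · simp [T]
        · by_cases hj : j ∈ E <;> simp [T, hj]
      have hinj : LinearMap.ker T = ⊥ := by
        rw [LinearMap.ker_eq_bot']
        intro v hv
        rw [hT, Prod.mk_eq_zero] at hv
        refine hker v (fun j hj => ?_) hv.1
        simpa [hj] using congrFun hv.2 j
      have hcl := (LinearMap.isClosedEmbedding_of_injective hinj).isClosedMap _
        (isClosed_supportCone P E)
      have heq : (M *ᵥ ·) '' supportCone P E =
          (fun y => (y, (0 : Fin n → ℝ))) ⁻¹' (T '' supportCone P E) := by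
        ext y
        constructor
        · rintro ⟨v, hv, rfl⟩
          refine ⟨v, hv, ?_⟩
          rw [hT]
          ext j
          · rfl
          · by_cases hj : j ∈ E
            · simp [hj]
            · simp [hv.2 j hj]
        · rintro ⟨v, hv, h⟩
          rw [hT, Prod.mk.injEq] at h
          exact ⟨v, hv, h.1⟩
      rw [heq]
      exact hcl.preimage (by fun_prop)
    · push Not at hker
      obtain ⟨h, hE, hM, hne⟩ := hker
      have heq : (M *ᵥ ·) '' supportCone P E =
          ⋃ j ∈ E, (M *ᵥ ·) '' supportCone P (E.erase j) := by
        refine Set.Subset.antisymm ?_ ?_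
        · rintro _ ⟨v, hv, rfl⟩
          obtain ⟨j, hj, w, hw, hwv⟩ := exists_mem_supportCone_erase M P E hE hM hne hv
          exact Set.mem_biUnion hj ⟨w, hw, hwv⟩
        · exact Set.iUnion₂_subset fun j _ => Set.image_mono (supportCone_erase_subset P E j)
      rw [heq]
      exact isClosed_biUnion_finset fun j hj => ih _ (Finset.erase_ssubset hj)

lemma exists_setOf_nnlsFeasible_eq (A : Matrix (Fin m) (Fin n) ℝ) (s : State m n) :
    ∃ E : Finset (Fin n), {v | NNLSFeasible A s v} = supportCone {j | s.x j = 0} E := by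
  classical
  refine ⟨Finset.univ.filter (· ∈ equicorrelationSet A s.p), ?_⟩
  ext v
  simp [supportCone, NNLSFeasible]

lemma exists_isNNLSSolution (A : Matrix (Fin m) (Fin n) ℝ) (s : State m n) :
    ∃ v, IsNNLSSolution A s v := by
  obtain ⟨E, hE⟩ := exists_setOf_nnlsFeasible_eq A s
  obtain ⟨_, ⟨v, hv, rfl⟩, hmin⟩ := exists_sqNorm_add_le
    (isClosed_image_supportCone (A * signMatrix A s.p) {j | s.x j = 0} E)
    ⟨_, 0, ⟨by simp, by simp⟩, rfl⟩ (s.t • s.p)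
  rw [← hE] at hv
  refine ⟨v, hv, fun w hw => hmin _ ⟨w, ?_, rfl⟩⟩
  rw [← hE]
  exact hw

lemma isClosed_setOf_isNNLSSolution (A : Matrix (Fin m) (Fin n) ℝ) (s : State m n) :
    IsClosed {v | IsNNLSSolution A s v} := by
  obtain ⟨E, hE⟩ := exists_setOf_nnlsFeasible_eq A s
  have : {v | IsNNLSSolution A s v} = {v | NNLSFeasible A s v} ∩
      ⋂ w, ⋂ _ : NNLSFeasible A s w,
        {v | sqNorm (residual A s v) ≤ sqNorm (residual A s w)} := by
    ext v
    simp [IsNNLSSolution]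
  rw [this, hE]
  refine (isClosed_supportCone _ _).inter
    (isClosed_iInter fun w => isClosed_iInter fun _ => isClosed_le ?_ continuous_const)
  refine continuous_sqNorm.comp ?_
  unfold residual
  fun_prop

lemma NNLSFeasible.midpoint {A : Matrix (Fin m) (Fin n) ℝ} {s : State m n} {v w : Fin n → ℝ}
    (hv : NNLSFeasible A s v) (hw : NNLSFeasible A s w) :
    NNLSFeasible A s ((1 / 2 : ℝ) • (v + w)) := by
  refine ⟨fun j hj hx => ?_, fun j hj => by simp [hv.2 j hj, hw.2 j hj]⟩
  have h1 := hv.1 j hj hx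
  have h2 := hw.1 j hj hx
  simp only [Pi.smul_apply, Pi.add_apply, smul_eq_mul]
  positivity

lemma IsNNLSSolution.midpoint {A : Matrix (Fin m) (Fin n) ℝ} {s : State m n} {v w : Fin n → ℝ}
    (hv : IsNNLSSolution A s v) (hw : IsNNLSSolution A s w) :
    IsNNLSSolution A s ((1 / 2 : ℝ) • (v + w)) := by
  refine ⟨hv.1.midpoint hw.1, fun z hz => ?_⟩
  have hres : residual A s ((1 / 2 : ℝ) • (v + w)) =
      (1 / 2 : ℝ) • (residual A s v + residual A s w) := by
    simp only [residual, Matrix.mulVec_smul, Matrix.mulVec_add]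
    module
  rw [hres, sqNorm_midpoint]
  have h1 := hv.2 z hz
  have h2 := hw.2 z hz
  have h3 := sqNorm_nonneg (residual A s v - residual A s w)
  linarith

lemma existsUnique_isMinNormNNLSSolution (A : Matrix (Fin m) (Fin n) ℝ) (s : State m n) :
    ∃! v, IsMinNormNNLSSolution A s v := by
  obtain ⟨v, hv, hmin⟩ := exists_sqNorm_add_le (isClosed_setOf_isNNLSSolution A s)
    (exists_isNNLSSolution A s) 0
  simp only [add_zero] at hmin
  refine ⟨v, ⟨hv, hmin⟩, fun w hw => ?_⟩
  have h := hmin _ (IsNNLSSolution.midpoint hv hw.1)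
  rw [sqNorm_midpoint] at h
  have h1 := hw.2 v hv
  have h2 := sqNorm_nonneg (v - w)
  have h3 : sqNorm (v - w) = 0 := by linarith
  exact (sub_eq_zero.1 (sqNorm_eq_zero.1 h3)).symm

lemma vHat_spec (A : Matrix (Fin m) (Fin n) ℝ) (s : State m n) :
    IsMinNormNNLSSolution A s (vHat A s) :=
  Classical.epsilon_spec (existsUnique_isMinNormNNLSSolution A s).exists

/-! ### Optimality conditions -/

/-- The optimality conditions linking a primal vector `x` and a dual vector `p` at hyperparameter
`t`: the dual vector is the rescaled residual, and `-Aᵀ p` is a subgradient of the `ℓ₁` norm at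
`x`. For `t = 0` they are the optimality conditions of basis pursuit. -/
structure KKT (A : Matrix (Fin m) (Fin n) ℝ) (b : Fin m → ℝ) (t : ℝ) (x : Fin n → ℝ)
    (p : Fin m → ℝ) : Prop where
  stationary : t • p = A *ᵥ x - b
  feasible : ∀ j, |(Aᵀ *ᵥ p) j| ≤ 1
  complementary : ∀ j, -((Aᵀ *ᵥ p) j * x j) = |x j|

lemma transpose_mulVec_dotProduct (A : Matrix (Fin m) (Fin n) ℝ) (p : Fin m → ℝ)
    (x : Fin n → ℝ) : (Aᵀ *ᵥ p) ⬝ᵥ x = p ⬝ᵥ (A *ᵥ x) := by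
  rw [Matrix.mulVec_transpose, Matrix.dotProduct_mulVec]

lemma norm_neg_transpose_mulVec_le_one_iff (A : Matrix (Fin m) (Fin n) ℝ) (p : Fin m → ℝ) :
    ‖-(Aᵀ *ᵥ p)‖ ≤ 1 ↔ ∀ j, |(Aᵀ *ᵥ p) j| ≤ 1 := by
  rw [norm_neg, pi_norm_le_iff_of_nonneg zero_le_one]
  simp only [Real.norm_eq_abs]

lemma neg_dotProduct_mulVec_le_l1Norm {A : Matrix (Fin m) (Fin n) ℝ} {p : Fin m → ℝ}
    (hp : ∀ j, |(Aᵀ *ᵥ p) j| ≤ 1) (z : Fin n → ℝ) : -(p ⬝ᵥ (A *ᵥ z)) ≤ l1Norm z := by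
  rw [← transpose_mulVec_dotProduct, dotProduct, ← Finset.sum_neg_distrib]
  refine Finset.sum_le_sum fun j _ => ?_
  calc -((Aᵀ *ᵥ p) j * z j) ≤ |(Aᵀ *ᵥ p) j * z j| := neg_le_abs _
    _ = |(Aᵀ *ᵥ p) j| * |z j| := abs_mul _ _
    _ ≤ 1 * |z j| := mul_le_mul_of_nonneg_right (hp j) (abs_nonneg _)
    _ = |z j| := one_mul _

namespace KKT

variable {A : Matrix (Fin m) (Fin n) ℝ} {b : Fin m → ℝ} {t : ℝ} {x : Fin n → ℝ} {p : Fin m → ℝ}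

lemma l1Norm_eq (h : KKT A b t x p) : l1Norm x = -(p ⬝ᵥ (A *ᵥ x)) := by
  rw [← transpose_mulVec_dotProduct, dotProduct, ← Finset.sum_neg_distrib]
  exact Finset.sum_congr rfl fun j _ => (h.complementary j).symm

lemma isPrimalSolution (h : KKT A b t x p) (ht : 0 ≤ t) : IsPrimalSolution A b t x := by
  unfold IsPrimalSolution
  have hx := h.l1Norm_eq
  split_ifs with h0
  · have hAx : A *ᵥ x = b := by
      have := h.stationary
      rw [h0, zero_smul] at this
      exact (sub_eq_zero.1 this.symm)
    refine ⟨hAx, fun z hz => ?_⟩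
    rw [hx, hAx, ← hz]
    exact neg_dotProduct_mulVec_le_l1Norm h.feasible z
  · have htpos : 0 < t := lt_of_le_of_ne ht (Ne.symm h0)
    intro z
    have hz := neg_dotProduct_mulVec_le_l1Norm h.feasible z
    have hexp : A *ᵥ z - b = t • p + (A *ᵥ z - A *ᵥ x) := by
      rw [h.stationary]
      module
    have hnn := sqNorm_nonneg (A *ᵥ z - A *ᵥ x)
    have hsq : 1 / (2 * t) * sqNorm (A *ᵥ z - b) = 1 / (2 * t) * sqNorm (A *ᵥ x - b) +
        (p ⬝ᵥ (A *ᵥ z) - p ⬝ᵥ (A *ᵥ x)) + 1 / (2 * t) * sqNorm (A *ᵥ z - A *ᵥ x) := by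
      rw [hexp, sqNorm_add, h.stationary.symm, smul_dotProduct, dotProduct_sub, smul_eq_mul]
      field_simp
    have : 0 ≤ 1 / (2 * t) * sqNorm (A *ᵥ z - A *ᵥ x) := by positivity
    rw [hsq]
    linarith

/-- The inner products `⟨x, Aᵀ q⟩` are smallest, over the dual feasible `q`, at `q = p`. -/
lemma dotProduct_sub_nonneg (h : KKT A b t x p) {q : Fin m → ℝ}
    (hq : ∀ j, |(Aᵀ *ᵥ q) j| ≤ 1) : 0 ≤ (q - p) ⬝ᵥ (A *ᵥ x) := by
  have h1 := h.l1Norm_eq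
  have h2 := neg_dotProduct_mulVec_le_l1Norm hq x
  rw [sub_dotProduct]
  linarith

lemma isDualSolution (h : KKT A b t x p) (ht : 0 ≤ t) : IsDualSolution A b t p := by
  refine ⟨(norm_neg_transpose_mulVec_le_one_iff A p).2 h.feasible, fun q hq => ?_⟩
  have hq' := h.dotProduct_sub_nonneg ((norm_neg_transpose_mulVec_le_one_iff A q).1 hq)
  have hAx : A *ᵥ x = t • p + b := by
    rw [h.stationary]
    module
  have hexp : sqNorm q = sqNorm p + 2 * (p ⬝ᵥ (q - p)) + sqNorm (q - p) := by
    rw [← sqNorm_add]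
    congr 1
    module
  have hnn : 0 ≤ t / 2 * sqNorm (q - p) := mul_nonneg (by linarith) (sqNorm_nonneg _)
  rw [hAx, dotProduct_add, dotProduct_smul, smul_eq_mul, dotProduct_comm _ p,
    sub_dotProduct q p b] at hq'
  rw [hexp]
  linarith

/-- The dual solution at a positive hyperparameter is unique. -/
lemma dual_unique (ht : 0 < t) (h : KKT A b t x p) {x' : Fin n → ℝ} {p' : Fin m → ℝ}
    (h' : KKT A b t x' p') : p = p' := by
  have h1 := h.dotProduct_sub_nonneg h'.feasible
  have h2 := h'.dotProduct_sub_nonneg h.feasible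
  have hA : A *ᵥ x = A *ᵥ x' + t • (p - p') := by
    rw [smul_sub, h.stationary, h'.stationary]
    module
  rw [hA, dotProduct_add, dotProduct_smul, smul_eq_mul,
    show p' - p = (-1 : ℝ) • (p - p') by module, smul_dotProduct, smul_dotProduct,
    ← sqNorm_eq_dotProduct] at h1
  simp only [smul_eq_mul] at h1
  have h3 := sqNorm_nonneg (p - p')
  have h4 : t * sqNorm (p - p') ≤ 0 := by linarith
  have h5 : sqNorm (p - p') = 0 := le_antisymm (nonpos_of_mul_nonpos_right h4 ht) h3
  exact sub_eq_zero.1 (sqNorm_eq_zero.1 h5)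

lemma abs_eq_one_of_ne_zero (h : KKT A b t x p) {j : Fin n} (hx : x j ≠ 0) :
    |(Aᵀ *ᵥ p) j| = 1 := by
  have h1 := congrArg abs (h.complementary j)
  rw [abs_neg, abs_mul, abs_abs] at h1
  exact mul_right_cancel₀ (abs_ne_zero.2 hx) (by rw [h1, one_mul])

end KKT

/-! ### Directions of the homotopy -/

lemma sgn_mul_self (r : ℝ) : sgn r * sgn r = 1 := by
  unfold sgn
  split_ifs <;> norm_num

lemma sgn_neg_mul (r : ℝ) : sgn (-r) * r = -|r| := by
  unfold sgn
  split_ifs with h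
  · rw [abs_of_nonpos (by linarith)]
    ring
  · rw [abs_of_nonneg (by linarith)]
    ring

lemma abs_sgn (r : ℝ) : |sgn r| = 1 := by
  unfold sgn
  split_ifs <;> norm_num

lemma signMatrix_mulVec_apply (A : Matrix (Fin m) (Fin n) ℝ) (p : Fin m → ℝ) (v : Fin n → ℝ)
    (j : Fin n) : (signMatrix A p *ᵥ v) j = sgn (-(Aᵀ *ᵥ p) j) * v j := by
  simp [signMatrix, Matrix.mulVec_diagonal]

lemma signMatrix_mulVec_mulVec (A : Matrix (Fin m) (Fin n) ℝ) (p : Fin m → ℝ)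
    (v : Fin n → ℝ) : signMatrix A p *ᵥ (signMatrix A p *ᵥ v) = v := by
  ext j
  rw [signMatrix_mulVec_apply, signMatrix_mulVec_apply, ← mul_assoc, sgn_mul_self, one_mul]

lemma sqNorm_signMatrix_mulVec (A : Matrix (Fin m) (Fin n) ℝ) (p : Fin m → ℝ)
    (v : Fin n → ℝ) : sqNorm (signMatrix A p *ᵥ v) = sqNorm v := by
  refine Finset.sum_congr rfl fun j _ => ?_
  rw [signMatrix_mulVec_apply, mul_pow, pow_two (sgn _), sgn_mul_self, one_mul]

/-- The vector `D Aᵀ ξ`, the rate of change of the signed correlations. -/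
noncomputable def corrRate (A : Matrix (Fin m) (Fin n) ℝ) (s : State m n) : Fin n → ℝ :=
  (signMatrix A s.p * Aᵀ) *ᵥ xi A s

lemma corrRate_apply (A : Matrix (Fin m) (Fin n) ℝ) (s : State m n) (j : Fin n) :
    corrRate A s j = sgn (-(Aᵀ *ᵥ s.p) j) * (Aᵀ *ᵥ xi A s) j := by
  rw [corrRate, ← Matrix.mulVec_mulVec, signMatrix_mulVec_apply]

lemma signMatrix_mul_transpose_mulVec_apply (A : Matrix (Fin m) (Fin n) ℝ) (p : Fin m → ℝ)
    (j : Fin n) : ((signMatrix A p * Aᵀ) *ᵥ p) j = -|(Aᵀ *ᵥ p) j| := by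
  rw [← Matrix.mulVec_mulVec, signMatrix_mulVec_apply, sgn_neg_mul]

lemma mem_equicorrelationSet_iff (A : Matrix (Fin m) (Fin n) ℝ) (p : Fin m → ℝ) (j : Fin n) :
    j ∈ equicorrelationSet A p ↔ |(Aᵀ *ᵥ p) j| = 1 := by
  simp [equicorrelationSet]

lemma residual_add_smul (A : Matrix (Fin m) (Fin n) ℝ) (s : State m n) (v h : Fin n → ℝ)
    (ε : ℝ) : residual A s (v + ε • h) = residual A s v + ε • ((A * signMatrix A s.p) *ᵥ h) := by
  simp only [residual, Matrix.mulVec_add, Matrix.mulVec_smul]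
  module

lemma xi_dotProduct_mulVec (A : Matrix (Fin m) (Fin n) ℝ) (s : State m n) (h : Fin n → ℝ) :
    xi A s ⬝ᵥ ((A * signMatrix A s.p) *ᵥ h) = corrRate A s ⬝ᵥ h := by
  rw [← transpose_mulVec_dotProduct, Matrix.transpose_mul]
  simp [corrRate, signMatrix]

/-- The one-sided derivative of the least-squares objective is nonnegative in every direction that
stays feasible for a while. -/
lemma corrRate_dotProduct_nonneg {A : Matrix (Fin m) (Fin n) ℝ} {s : State m n}
    {h : Fin n → ℝ} (hf : ∀ ε : ℝ, 0 < ε → ε ≤ 1 → NNLSFeasible A s (vHat A s + ε • h)) :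
    0 ≤ corrRate A s ⬝ᵥ h := by
  rw [← xi_dotProduct_mulVec]
  set r := (A * signMatrix A s.p) *ᵥ h with hr
  by_contra! hneg
  have hN := sqNorm_nonneg r
  set c := xi A s ⬝ᵥ r with hc
  -- The objective changes by `2 ε c + ε² ‖r‖²`, which is negative for this `ε`.
  set ε := min 1 (-c / (sqNorm r + 1)) with hε
  have hε0 : 0 < ε := lt_min one_pos (div_pos (by linarith) (by linarith))
  have h1 := (vHat_spec A s).1.2 _ (hf ε hε0 (min_le_left _ _))
  have hxi : residual A s (vHat A s) = xi A s := rfl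
  rw [residual_add_smul, ← hr, sqNorm_add, dotProduct_smul, sqNorm_smul, smul_eq_mul, hxi,
    ← hc] at h1
  have h2 : ε * (sqNorm r + 1) ≤ -c := by
    rw [← le_div_iff₀ (by linarith)]
    exact min_le_right _ _
  nlinarith

lemma corrRate_nonneg {A : Matrix (Fin m) (Fin n) ℝ} {s : State m n} {j : Fin n}
    (hj : |(Aᵀ *ᵥ s.p) j| = 1) : 0 ≤ corrRate A s j := by
  have := corrRate_dotProduct_nonneg (A := A) (s := s) (h := Pi.single j 1) fun ε hε _ => by
    have hv := (vHat_spec A s).1.1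
    refine ⟨fun i hi hx => ?_, fun i hi => ?_⟩
    · have h1 := hv.1 i hi hx
      have h2 : 0 ≤ (Pi.single j 1 : Fin n → ℝ) i := by
        by_cases hij : i = j
        · subst hij
          simp
        · simp [hij]
      simp only [Pi.add_apply, Pi.smul_apply, smul_eq_mul]
      positivity
    · have hij : i ≠ j := by
        rintro rfl
        exact hi ((mem_equicorrelationSet_iff A s.p i).2 hj)
      simp [hv.2 i hi, hij]
  simpa using this

lemma corrRate_eq_zero {A : Matrix (Fin m) (Fin n) ℝ} {s : State m n} {j : Fin n}
    (hj : |(Aᵀ *ᵥ s.p) j| = 1) (hx : s.x j ≠ 0) : corrRate A s j = 0 := by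
  refine le_antisymm ?_ (corrRate_nonneg hj)
  have := corrRate_dotProduct_nonneg (A := A) (s := s) (h := Pi.single j (-1)) fun ε hε _ => by
    have hv := (vHat_spec A s).1.1
    refine ⟨fun i hi hxi => ?_, fun i hi => ?_⟩
    · have hij : i ≠ j := by
        rintro rfl
        exact hx hxi
      simpa [hij] using hv.1 i hi hxi
    · have hij : i ≠ j := by
        rintro rfl
        exact hi ((mem_equicorrelationSet_iff A s.p i).2 hj)
      simp [hv.2 i hi, hij]
  simp at this
  linarith

lemma vHat_eq_zero {A : Matrix (Fin m) (Fin n) ℝ} {s : State m n} {j : Fin n}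
    (hj : |(Aᵀ *ᵥ s.p) j| ≠ 1) : vHat A s j = 0 :=
  (vHat_spec A s).1.1.2 j fun h => hj ((mem_equicorrelationSet_iff A s.p j).1 h)

lemma vHat_nonneg {A : Matrix (Fin m) (Fin n) ℝ} {s : State m n} {j : Fin n}
    (hx : s.x j = 0) : 0 ≤ vHat A s j := by
  by_cases hj : |(Aᵀ *ᵥ s.p) j| = 1
  · exact (vHat_spec A s).1.1.1 j ((mem_equicorrelationSet_iff A s.p j).2 hj) hx
  · exact (vHat_eq_zero hj).ge

/-- Complementary slackness of the nonnegative least-squares problem. -/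
lemma corrRate_eq_zero_of_vHat_ne_zero {A : Matrix (Fin m) (Fin n) ℝ} {s : State m n} {j : Fin n}
    (hvj : vHat A s j ≠ 0) : corrRate A s j = 0 := by
  have hj : |(Aᵀ *ᵥ s.p) j| = 1 := by
    by_contra h
    exact hvj (vHat_eq_zero h)
  by_cases hx : s.x j = 0
  swap
  · exact corrRate_eq_zero hj hx
  have hpos : 0 < vHat A s j := lt_of_le_of_ne (vHat_nonneg hx) hvj.symm
  refine le_antisymm ?_ (corrRate_nonneg hj)
  have := corrRate_dotProduct_nonneg (A := A) (s := s)
      (h := Pi.single j (-vHat A s j)) fun ε hε hε1 => by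
    have hv := (vHat_spec A s).1.1
    refine ⟨fun i hi hxi => ?_, fun i hi => ?_⟩
    · by_cases hij : i = j
      · subst hij
        simp only [Pi.add_apply, Pi.smul_apply, smul_eq_mul, Pi.single_eq_same]
        nlinarith
      · simpa [hij] using hv.1 i hi hxi
    · have hij : i ≠ j := by
        rintro rfl
        exact hi ((mem_equicorrelationSet_iff A s.p i).2 hj)
      simp [hv.2 i hi, hij]
  simp at this
  nlinarith

/-! ### The next breakpoint -/

lemma eq_zero_of_transpose_mulVec_eq_zero {A : Matrix (Fin m) (Fin n) ℝ} (hA : A.rank = m)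
    {y : Fin m → ℝ} (hy : Aᵀ *ᵥ y = 0) : y = 0 := by
  have h1 := LinearMap.finrank_range_add_finrank_ker Aᵀ.mulVecLin
  have h2 : Module.finrank ℝ (LinearMap.range Aᵀ.mulVecLin) = m :=
    (Matrix.rank_transpose A).trans hA
  rw [h2, Module.finrank_fin_fun, Nat.add_eq_left, Submodule.finrank_eq_zero] at h1
  exact (LinearMap.ker_eq_bot'.1 h1) y hy

lemma xi_eq_zero {A : Matrix (Fin m) (Fin n) ℝ} (hA : A.rank = m) {s : State m n}
    (h : ∀ j, corrRate A s j = 0) : xi A s = 0 := by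
  refine eq_zero_of_transpose_mulVec_eq_zero hA (funext fun j => ?_)
  have hj := h j
  rw [corrRate_apply] at hj
  refine (mul_eq_zero.1 hj).resolve_left fun h0 => ?_
  simpa [h0] using abs_sgn (-(Aᵀ *ᵥ s.p) j)

/-- A finite infimum of real numbers in the extended reals is `⊤` or attained. -/
lemma iInf_ite_coe {ι : Type*} [Finite ι] (p : ι → Prop) [DecidablePred p] (r : ι → ℝ) :
    ((∀ j, ¬ p j) ∧ (⨅ j, if p j then (r j : EReal) else ⊤) = ⊤) ∨
      ∃ j₀, p j₀ ∧ (⨅ j, if p j then (r j : EReal) else ⊤) = r j₀ ∧ ∀ j, p j → r j₀ ≤ r j := by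
  by_cases h : ∃ j, p j
  · right
    obtain ⟨j₁, hj₁⟩ := h
    have : Nonempty ι := ⟨j₁⟩
    obtain ⟨j₀, hj₀⟩ := exists_eq_ciInf_of_finite (f := fun j => if p j then (r j : EReal) else ⊤)
    have hle : ∀ j, (if p j₀ then (r j₀ : EReal) else ⊤) ≤ if p j then (r j : EReal) else ⊤ :=
      fun j => hj₀ ▸ iInf_le _ j
    have hp : p j₀ := by
      by_contra hp
      have := hle j₁
      simp [hp, hj₁] at this
    refine ⟨j₀, hp, by rw [← hj₀, if_pos hp], fun j hj => ?_⟩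
    have := hle j
    rw [if_pos hp, if_pos hj] at this
    exact_mod_cast this
  · left
    push Not at h
    exact ⟨h, by simp [h]⟩

variable {A : Matrix (Fin m) (Fin n) ℝ} {b : Fin m → ℝ} {s : State m n}

/-- The hyperparameter `T₊` at which a dual constraint blocks the dual path. -/
lemma tPlus_spec (ht : 0 < s.t) (hp : ∀ j, |(Aᵀ *ᵥ s.p) j| ≤ 1) :
    ((∀ j, corrRate A s j = 0) ∧ tPlus A s = (0 : ℝ)) ∨
      ∃ c : ℝ, 0 < c ∧ tPlus A s = (s.t / (1 + s.t * c) : ℝ) ∧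
        (∃ j, corrRate A s j ≠ 0 ∧
          c = (sgn (corrRate A s j) + |(Aᵀ *ᵥ s.p) j|) / corrRate A s j) ∧
        ∀ j, corrRate A s j ≠ 0 →
          c ≤ (sgn (corrRate A s j) + |(Aᵀ *ᵥ s.p) j|) / corrRate A s j := by
  classical
  have hC : cHat A s = ⨅ j, if corrRate A s j ≠ 0 then
      (((sgn (corrRate A s j) + |(Aᵀ *ᵥ s.p) j|) / corrRate A s j : ℝ) : EReal) else ⊤ := by
    refine iInf_congr fun j => ?_
    rw [signMatrix_mul_transpose_mulVec_apply, sub_neg_eq_add, ite_not]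
    rfl
  rcases iInf_ite_coe (fun j => corrRate A s j ≠ 0)
    (fun j => (sgn (corrRate A s j) + |(Aᵀ *ᵥ s.p) j|) / corrRate A s j) with ⟨h0, hinf⟩ |
      ⟨j, hj, hinf, hmin⟩
  · left
    refine ⟨fun j => not_not.1 (h0 j), ?_⟩
    rw [tPlus, hC, hinf, EReal.coe_mul_top_of_pos ht, ← EReal.coe_one, EReal.coe_add_top,
      EReal.div_top, EReal.coe_zero]
  · right
    refine ⟨_, ?_, ?_, ⟨j, hj, rfl⟩, hmin⟩
    · rcases lt_or_gt_of_ne hj with hneg | hpos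
      · have hlt : |(Aᵀ *ᵥ s.p) j| < 1 :=
          lt_of_le_of_ne (hp j) fun h => (corrRate_nonneg h).not_gt hneg
        have hsgn : sgn (corrRate A s j) = -1 := if_neg (not_le.2 hneg)
        rw [hsgn]
        exact div_pos_of_neg_of_neg (by linarith) hneg
      · have hsgn : sgn (corrRate A s j) = 1 := if_pos hpos.le
        rw [hsgn]
        positivity
    · rw [tPlus, hC, hinf, ← EReal.coe_one, ← EReal.coe_mul, ← EReal.coe_add, ← EReal.coe_div]

/-- The hyperparameter `T₋` at which a sign constraint blocks the primal path. -/
lemma tMinus_spec (ht : 0 < s.t) :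
    (tMinus A s = ⊥ ∨ ∃ M : ℝ, tMinus A s = M ∧ M < s.t ∧
      ∃ j, s.x j ≠ 0 ∧ vHat A s j < 0 ∧ |s.x j| + (1 - M / s.t) * vHat A s j = 0) ∧
    ∀ τ : ℝ, tMinus A s ≤ τ → 0 ≤ τ → τ ≤ s.t → ∀ j, 0 ≤ |s.x j| + (1 - τ / s.t) * vHat A s j := by
  classical
  set q : Fin n → Prop := fun j =>
    j ∈ equicorrelationSet A s.p ∧ s.x j ≠ 0 ∧ vHat A s j ≤ -|s.x j| with hq
  have hneg : ∀ j, q j → vHat A s j < 0 := fun j hj => by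
    have := abs_pos.2 hj.2.1
    linarith [hj.2.2]
  have hT : tMinus A s = (s.t : EReal) *
      (1 - ⨅ j, if q j then ((|s.x j| / |vHat A s j| : ℝ) : EReal) else ⊤) := by
    rw [tMinus]
    congr 2
    exact iInf_congr fun j => iInf_eq_if _
  -- A coordinate outside the index set of the infimum reaches zero at the earliest for `τ < 0`.
  have hout : ∀ τ : ℝ, 0 ≤ τ → τ ≤ s.t → ∀ j, ¬ q j →
      0 ≤ |s.x j| + (1 - τ / s.t) * vHat A s j := by
    intro τ h0 h1 j hj
    have hl : 0 ≤ τ / s.t := by positivity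
    have hu : τ / s.t ≤ 1 := (div_le_one ht).2 h1
    rcases le_or_gt 0 (vHat A s j) with hv | hv
    · have := mul_nonneg (by linarith : 0 ≤ 1 - τ / s.t) hv
      positivity
    · have hE : j ∈ equicorrelationSet A s.p := by
        by_contra hc
        exact hv.ne ((vHat_spec A s).1.1.2 j hc)
      have hx : s.x j ≠ 0 := fun hx => (vHat_nonneg hx).not_gt hv
      have : -|s.x j| < vHat A s j := by
        by_contra! hc
        exact hj ⟨hE, hx, hc⟩
      nlinarith
  rcases iInf_ite_coe q (fun j => |s.x j| / |vHat A s j|) with ⟨h0, hinf⟩ | ⟨j₀, hj₀, hinf, hmin⟩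
  · rw [hinf, show (1 - ⊤ : EReal) = ⊥ from rfl, EReal.coe_mul_bot_of_pos ht] at hT
    exact ⟨Or.inl hT, fun τ _ hτ0 hτ1 j => hout τ hτ0 hτ1 j (h0 j)⟩
  · rw [hinf, ← EReal.coe_one, ← EReal.coe_sub, ← EReal.coe_mul] at hT
    have hx0 := abs_pos.2 hj₀.2.1
    have hv0 := hneg j₀ hj₀
    have hv0' : |vHat A s j₀| = -vHat A s j₀ := abs_of_neg hv0
    have hr0 : 0 < |s.x j₀| / |vHat A s j₀| := div_pos hx0 (abs_pos.2 hv0.ne)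
    refine ⟨Or.inr ⟨_, hT, ?_, j₀, hj₀.2.1, hv0, ?_⟩, ?_⟩
    · nlinarith
    · rw [mul_div_cancel_left₀ _ ht.ne', hv0']
      have := hv0.ne
      field_simp
      ring
    · intro τ hτ hτ0 hτ1 j
      by_cases hj : q j
      swap
      · exact hout τ hτ0 hτ1 j hj
      rw [hT, EReal.coe_le_coe_iff] at hτ
      have hv := hneg j hj
      have h1 : 1 - τ / s.t ≤ |s.x j| / |vHat A s j| := by
        refine le_trans ?_ (hmin j hj)
        rw [sub_le_comm, le_div_iff₀ ht]
        linarith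
      rw [abs_of_neg hv, le_div_iff₀ (by linarith)] at h1
      linarith

/-- What the next hyperparameter is: the path can be followed down to it, it vanishes only if
`ξ = 0`, and if it is positive then a sign constraint or a dual constraint blocks the path. -/
lemma nextT_spec (ht : 0 < s.t) (hp : ∀ j, |(Aᵀ *ᵥ s.p) j| ≤ 1) :
    0 ≤ nextT A s ∧ nextT A s < s.t ∧
    (∀ τ, nextT A s ≤ τ → τ ≤ s.t → ∀ j, 0 ≤ |s.x j| + (1 - τ / s.t) * vHat A s j) ∧
    (∀ τ, 0 < τ → nextT A s ≤ τ → ∀ j, corrRate A s j ≠ 0 →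
      1 / τ - 1 / s.t ≤ (sgn (corrRate A s j) + |(Aᵀ *ᵥ s.p) j|) / corrRate A s j) ∧
    (nextT A s = 0 → ∀ j, corrRate A s j = 0) ∧
    (0 < nextT A s →
      (∃ j, s.x j ≠ 0 ∧ vHat A s j < 0 ∧ |s.x j| + (1 - nextT A s / s.t) * vHat A s j = 0) ∨
      ∃ j, corrRate A s j ≠ 0 ∧ (1 / nextT A s - 1 / s.t) * corrRate A s j =
        sgn (corrRate A s j) + |(Aᵀ *ᵥ s.p) j|) := by
  obtain ⟨hMc, hM⟩ := tMinus_spec (A := A) ht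
  have hcpos : ∀ {c : ℝ}, 0 < c → 0 < 1 + s.t * c := fun hc => by positivity
  have hinv : ∀ {c : ℝ}, 0 < c → 1 / (s.t / (1 + s.t * c)) - 1 / s.t = c := fun {c} hc => by
    have := hcpos hc
    field_simp
    ring
  obtain ⟨P, hP, hP0, hPt, hPc, hPz, hPb⟩ : ∃ P : ℝ, tPlus A s = P ∧ 0 ≤ P ∧ P < s.t ∧
      (∀ τ, 0 < τ → P ≤ τ → ∀ j, corrRate A s j ≠ 0 →
        1 / τ - 1 / s.t ≤ (sgn (corrRate A s j) + |(Aᵀ *ᵥ s.p) j|) / corrRate A s j) ∧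
      (P = 0 → ∀ j, corrRate A s j = 0) ∧
      (0 < P → ∃ j, corrRate A s j ≠ 0 ∧ (1 / P - 1 / s.t) * corrRate A s j =
        sgn (corrRate A s j) + |(Aᵀ *ᵥ s.p) j|) := by
    rcases tPlus_spec ht hp with ⟨h0, hT⟩ | ⟨c, hc, hT, ⟨j, hj, hcj⟩, hmin⟩
    · exact ⟨0, hT, le_rfl, ht, fun _ _ _ j hj => absurd (h0 j) hj, fun _ => h0,
        fun h => absurd h (lt_irrefl _)⟩
    · have hPpos : 0 < s.t / (1 + s.t * c) := div_pos ht (hcpos hc)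
      refine ⟨_, hT, hPpos.le, ?_, fun τ hτ hle i hi => le_trans ?_ (hmin i hi),
        fun h => absurd h hPpos.ne', fun _ => ⟨j, hj, ?_⟩⟩
      · rw [div_lt_iff₀ (hcpos hc)]
        nlinarith [mul_pos ht hc, mul_pos ht (mul_pos ht hc)]
      · rw [← hinv hc]
        have := one_div_le_one_div_of_le hPpos hle
        linarith
      · rw [hinv hc, hcj, div_mul_cancel₀ _ hj]
  rcases hMc with hbot | ⟨M, hMM, hMt, hMb⟩
  · have hN : nextT A s = P := by
      rw [nextT, hbot, hP, max_eq_right bot_le, EReal.toReal_coe]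
    rw [hN]
    refine ⟨hP0, hPt, fun τ hτ hτt => hM τ (by simp [hbot]) (hP0.trans hτ) hτt, hPc, hPz,
      fun h => Or.inr (hPb h)⟩
  · have hN : nextT A s = max M P := by
      rw [nextT, hMM, hP]
      rcases le_total M P with h | h
      · rw [max_eq_right (EReal.coe_le_coe_iff.2 h), EReal.toReal_coe, max_eq_right h]
      · rw [max_eq_left (EReal.coe_le_coe_iff.2 h), EReal.toReal_coe, max_eq_left h]
    rw [hN]
    refine ⟨le_max_of_le_right hP0, max_lt hMt hPt, fun τ hτ hτt => hM τ ?_ ?_ hτt,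
      fun τ h0 hτ => hPc τ h0 ((le_max_right _ _).trans hτ), fun h => hPz ?_, fun h => ?_⟩
    · rw [hMM, EReal.coe_le_coe_iff]
      exact (le_max_left _ _).trans hτ
    · exact hP0.trans ((le_max_right _ _).trans hτ)
    · exact le_antisymm (h ▸ le_max_right M P) hP0
    · rcases le_total M P with hle | hle
      · rw [max_eq_right hle] at h ⊢
        exact Or.inr (hPb h)
      · rw [max_eq_left hle]
        exact Or.inl hMb

/-! ### One iteration follows the solution path -/

lemma signMatrix_mulVec_transpose_add_smul (A : Matrix (Fin m) (Fin n) ℝ) (s : State m n)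
    (c : ℝ) (j : Fin n) : sgn (-(Aᵀ *ᵥ s.p) j) * (Aᵀ *ᵥ (s.p + c • xi A s)) j =
      -|(Aᵀ *ᵥ s.p) j| + c * corrRate A s j := by
  rw [Matrix.mulVec_add, Matrix.mulVec_smul, Pi.add_apply, Pi.smul_apply, mul_add, sgn_neg_mul,
    corrRate_apply, smul_eq_mul]
  ring

lemma abs_transpose_mulVec_add_smul (A : Matrix (Fin m) (Fin n) ℝ) (s : State m n)
    (c : ℝ) (j : Fin n) : |(Aᵀ *ᵥ (s.p + c • xi A s)) j| =
      |-|(Aᵀ *ᵥ s.p) j| + c * corrRate A s j| := by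
  rw [← signMatrix_mulVec_transpose_add_smul, abs_mul, abs_sgn, one_mul]

lemma KKT.primalPath_apply (h : KKT A b s.t s.x s.p) (τ : ℝ) (j : Fin n) :
    primalPath A s τ j =
      sgn (-(Aᵀ *ᵥ s.p) j) * (|s.x j| + (1 - τ / s.t) * vHat A s j) := by
  have hx : s.x j = sgn (-(Aᵀ *ᵥ s.p) j) * |s.x j| := by
    by_cases h0 : s.x j = 0
    · simp [h0]
    · have h1 := h.abs_eq_one_of_ne_zero h0
      rw [← h.complementary j, show -((Aᵀ *ᵥ s.p) j * s.x j) = -(Aᵀ *ᵥ s.p) j * s.x j by ring,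
        ← mul_assoc, mul_neg, sgn_neg_mul, h1]
      ring
  rw [primalPath, Pi.add_apply, Pi.smul_apply, signMatrix_mulVec_apply, smul_eq_mul, mul_add,
    ← hx]
  ring

/-- The optimality conditions along the path: stationarity holds by construction of `ξ`, and
complementarity because the rate of change of an active correlation vanishes wherever the primal
path is nonzero. -/
lemma KKT.path (h : KKT A b s.t s.x s.p) (ht : 0 < s.t) {τ c : ℝ}
    (hc : (τ * c) • xi A s = (1 - τ / s.t) • xi A s)
    (hfeas : ∀ j, |-|(Aᵀ *ᵥ s.p) j| + c * corrRate A s j| ≤ 1)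
    (hsign : ∀ j, 0 ≤ |s.x j| + (1 - τ / s.t) * vHat A s j) :
    KKT A b τ (primalPath A s τ) (s.p + c • xi A s) where
  stationary := by
    have hAD : A *ᵥ (signMatrix A s.p *ᵥ vHat A s) = xi A s - s.t • s.p := by
      rw [xi, residual, Matrix.mulVec_mulVec]
      module
    have hAx : A *ᵥ s.x = s.t • s.p + b := by
      rw [h.stationary]
      module
    rw [primalPath, Matrix.mulVec_add, Matrix.mulVec_smul, hAD, hAx, smul_add, smul_smul, hc,
      smul_sub, smul_smul, sub_mul, div_mul_cancel₀ _ ht.ne']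
    module
  feasible j := by
    rw [abs_transpose_mulVec_add_smul]
    exact hfeas j
  complementary j := by
    rw [h.primalPath_apply, abs_mul, abs_sgn, one_mul, abs_of_nonneg (hsign j), mul_left_comm,
      ← mul_assoc, signMatrix_mulVec_transpose_add_smul]
    by_cases hx : s.x j = 0 ∧ vHat A s j = 0
    · simp [hx.1, hx.2]
    · have hq : |(Aᵀ *ᵥ s.p) j| = 1 ∧ corrRate A s j = 0 := by
        by_cases hv : vHat A s j = 0
        · have hx' : s.x j ≠ 0 := fun h0 => hx ⟨h0, hv⟩
          exact ⟨h.abs_eq_one_of_ne_zero hx', corrRate_eq_zero (h.abs_eq_one_of_ne_zero hx') hx'⟩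
        · refine ⟨?_, corrRate_eq_zero_of_vHat_ne_zero hv⟩
          by_contra hc
          exact hv (vHat_eq_zero hc)
      rw [hq.1, hq.2]
      ring

lemma one_div_sub_one_div_nonneg {τ t : ℝ} (hτ : 0 < τ) (h : τ ≤ t) : 0 ≤ 1 / τ - 1 / t :=
  sub_nonneg.2 (one_div_le_one_div_of_le hτ h)

lemma mul_corrRate_bounds (ht : 0 < s.t) (hp : ∀ j, |(Aᵀ *ᵥ s.p) j| ≤ 1) {τ : ℝ}
    (hτ0 : 0 < τ) (hτ : nextT A s ≤ τ) (hτt : τ ≤ s.t) (j : Fin n) :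
    (1 / τ - 1 / s.t) * corrRate A s j ≤ 1 + |(Aᵀ *ᵥ s.p) j| ∧
      -(1 - |(Aᵀ *ᵥ s.p) j|) ≤ (1 / τ - 1 / s.t) * corrRate A s j := by
  have hc := one_div_sub_one_div_nonneg hτ0 hτt
  have hle := (nextT_spec ht hp).2.2.2.1 τ hτ0 hτ j
  have ha := hp j
  have ha0 := abs_nonneg ((Aᵀ *ᵥ s.p) j)
  rcases lt_trichotomy (corrRate A s j) 0 with hq | hq | hq
  · have hle := hle hq.ne
    rw [sgn, if_neg (not_le.2 hq), le_div_iff_of_neg hq] at hle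
    have := mul_nonneg hc (neg_nonneg.2 hq.le)
    constructor <;> linarith
  · rw [hq]
    constructor <;> linarith
  · have hle := hle hq.ne'
    rw [sgn, if_pos hq.le, le_div_iff₀ hq] at hle
    have := mul_nonneg hc hq.le
    constructor <;> linarith

lemma KKT.path_of_pos (h : KKT A b s.t s.x s.p) (ht : 0 < s.t) {τ : ℝ} (hτ0 : 0 < τ)
    (hτ : nextT A s ≤ τ) (hτt : τ ≤ s.t) :
    KKT A b τ (primalPath A s τ) (s.p + (1 / τ - 1 / s.t) • xi A s) := by
  refine h.path ht ?_ (fun j => ?_) ((nextT_spec ht h.feasible).2.2.1 τ hτ hτt)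
  · congr 1
    field_simp
  · have := mul_corrRate_bounds ht h.feasible hτ0 hτ hτt j
    rw [abs_le]
    constructor <;> linarith

lemma KKT.path_dualPath (hA : A.rank = m) (h : KKT A b s.t s.x s.p) (ht : 0 < s.t) {τ : ℝ}
    (hτ : nextT A s ≤ τ) (hτt : τ ≤ s.t) :
    KKT A b τ (primalPath A s τ) (dualPath A s τ) := by
  have hspec := nextT_spec ht h.feasible
  by_cases h0 : nextT A s = 0
  · have hxi := xi_eq_zero hA (hspec.2.2.2.2.1 h0)
    have hpath := h.path ht (c := 0) (by simp [hxi])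
      (fun j => by simpa using h.feasible j) (hspec.2.2.1 τ hτ hτt)
    rw [dualPath, if_pos h0]
    rwa [zero_smul, add_zero] at hpath
  · rw [dualPath, if_neg h0]
    exact h.path_of_pos ht ((lt_of_le_of_ne hspec.1 (Ne.symm h0)).trans_le hτ) hτ hτt

lemma initState_t_pos (hA : A.rank = m) (hb : b ≠ 0) : 0 < (initState A b).t :=
  norm_pos_iff.2 fun h => hb (eq_zero_of_transpose_mulVec_eq_zero hA h)

lemma KKT.initState (hA : A.rank = m) (hb : b ≠ 0) :
    KKT A b (initState A b).t (initState A b).x (initState A b).p := by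
  have ht : 0 < ‖Aᵀ *ᵥ b‖ := initState_t_pos hA hb
  refine ⟨?_, fun j => ?_, fun j => by simp [BPDN.initState]⟩
  · simp [BPDN.initState, smul_smul, ht.ne']
  · simp only [BPDN.initState, Matrix.mulVec_neg, Matrix.mulVec_smul, Pi.neg_apply,
      Pi.smul_apply, smul_eq_mul, abs_neg, abs_mul, abs_of_pos (one_div_pos.2 ht)]
    rw [one_div, inv_mul_le_iff₀ ht, mul_one]
    exact norm_le_pi_norm (Aᵀ *ᵥ b) j

lemma KKT.step (hA : A.rank = m) (h : KKT A b s.t s.x s.p) (ht : 0 < s.t) :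
    KKT A b (step A s).t (step A s).x (step A s).p := by
  rw [BPDN.step, if_neg ht.ne']
  exact h.path_dualPath hA ht le_rfl (nextT_spec ht h.feasible).2.1.le

/-- As long as the hyperparameter has not reached zero, it is positive and the iterates satisfy
the optimality conditions. -/
lemma KKT.iterate (hA : A.rank = m) (hb : b ≠ 0) {k : ℕ}
    (hk : ∀ i < k, (iterate A b i).t ≠ 0) :
    0 ≤ (iterate A b k).t ∧
      KKT A b (iterate A b k).t (iterate A b k).x (iterate A b k).p := by
  induction k with
  | zero => exact ⟨(initState_t_pos hA hb).le, KKT.initState hA hb⟩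
  | succ k ih =>
    obtain ⟨h0, h1⟩ := ih fun i hi => hk i (by omega)
    have ht : 0 < (BPDN.iterate A b k).t := lt_of_le_of_ne h0 (hk k (by omega)).symm
    refine ⟨?_, h1.step hA ht⟩
    rw [BPDN.iterate, BPDN.step, if_neg ht.ne']
    exact (nextT_spec ht h1.feasible).1

/-! ### Faces of the dual polytope -/

/-- The face of the dual polytope containing `p` in its relative interior, recorded by the indices
at which the correlation `Aᵀ p` equals `1` and those at which it equals `-1`. -/
def facePattern (A : Matrix (Fin m) (Fin n) ℝ) (p : Fin m → ℝ) : Set (Fin n) × Set (Fin n) :=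
  ({j | (Aᵀ *ᵥ p) j = 1}, {j | (Aᵀ *ᵥ p) j = -1})

lemma facePattern_eq_iff {p p' : Fin m → ℝ} : facePattern A p = facePattern A p' ↔
    ∀ j, ((Aᵀ *ᵥ p) j = 1 ↔ (Aᵀ *ᵥ p') j = 1) ∧ ((Aᵀ *ᵥ p) j = -1 ↔ (Aᵀ *ᵥ p') j = -1) := by
  simp only [facePattern, Prod.mk.injEq, Set.ext_iff, Set.mem_ofPred_eq, forall_and]

lemma abs_eq_one_iff_of_facePattern_eq {p p' : Fin m → ℝ}
    (h : facePattern A p = facePattern A p') (j : Fin n) :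
    |(Aᵀ *ᵥ p) j| = 1 ↔ |(Aᵀ *ᵥ p') j| = 1 := by
  have := facePattern_eq_iff.1 h j
  rw [abs_eq zero_le_one, abs_eq zero_le_one, this.1, this.2]

lemma eq_of_facePattern_eq {p p' : Fin m → ℝ} (h : facePattern A p = facePattern A p')
    {j : Fin n} (hj : |(Aᵀ *ᵥ p) j| = 1) : (Aᵀ *ᵥ p') j = (Aᵀ *ᵥ p) j := by
  have := facePattern_eq_iff.1 h j
  rcases (abs_eq zero_le_one).1 hj with h1 | h1
  · rw [h1, this.1.1 h1]
  · rw [h1, this.2.1 h1]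

/-- The dual solutions lying in the relative interior of one face are those of an interval of
hyperparameters: the optimality conditions are convex in `(1 / τ, x / τ, p)` on a face. -/
lemma KKT.facePattern_eq_of_between {τ₁ τ₂ τ : ℝ} {x₁ x₂ x : Fin n → ℝ} {p₁ p₂ p : Fin m → ℝ}
    (h₁ : KKT A b τ₁ x₁ p₁) (h₂ : KKT A b τ₂ x₂ p₂) (h : KKT A b τ x p)
    (hface : facePattern A p₁ = facePattern A p₂) (hτ₂ : 0 < τ₂) (h₂τ : τ₂ ≤ τ) (hτ₁ : τ ≤ τ₁) :
    facePattern A p = facePattern A p₁ := by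
  have hτ : 0 < τ := hτ₂.trans_le h₂τ
  have hτ₁0 : 0 < τ₁ := hτ.trans_le hτ₁
  obtain ⟨α, β, hα, hβ, hαβ, hcomb⟩ : ∃ α β : ℝ, 0 ≤ α ∧ 0 ≤ β ∧ α + β = 1 ∧
      α * (1 / τ₁) + β * (1 / τ₂) = 1 / τ := by
    have hmem : 1 / τ ∈ segment ℝ (1 / τ₁) (1 / τ₂) := by
      rw [segment_eq_Icc (one_div_le_one_div_of_le hτ₂ (h₂τ.trans hτ₁))]
      exact ⟨one_div_le_one_div_of_le hτ hτ₁, one_div_le_one_div_of_le hτ₂ h₂τ⟩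
    obtain ⟨α, β, hα, hβ, hαβ, hcomb⟩ := hmem
    exact ⟨α, β, hα, hβ, hαβ, by simpa using hcomb⟩
  have hcorr : ∀ j, (Aᵀ *ᵥ (α • p₁ + β • p₂)) j =
      α * (Aᵀ *ᵥ p₁) j + β * (Aᵀ *ᵥ p₂) j := fun j => by
    simp [Matrix.mulVec_add, Matrix.mulVec_smul]
  have hkkt : KKT A b τ (τ • ((α / τ₁) • x₁ + (β / τ₂) • x₂)) (α • p₁ + β • p₂) := by
    refine ⟨?_, fun j => ?_, fun j => ?_⟩
    · have e₁ : p₁ = (1 / τ₁) • (A *ᵥ x₁ - b) := by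
        rw [← h₁.stationary, smul_smul, one_div_mul_cancel hτ₁0.ne', one_smul]
      have e₂ : p₂ = (1 / τ₂) • (A *ᵥ x₂ - b) := by
        rw [← h₂.stationary, smul_smul, one_div_mul_cancel hτ₂.ne', one_smul]
      have hb : τ * (α * (1 / τ₁) + β * (1 / τ₂)) = 1 := by
        rw [hcomb, mul_one_div_cancel hτ.ne']
      rw [Matrix.mulVec_smul, Matrix.mulVec_add, Matrix.mulVec_smul, Matrix.mulVec_smul]
      ext i
      have e₁' := congrFun e₁ i
      have e₂' := congrFun e₂ i
      simp only [Pi.smul_apply, Pi.add_apply, Pi.sub_apply, smul_eq_mul] at e₁' e₂' ⊢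
      rw [e₁', e₂']
      linear_combination (-b i) * hb
    · rw [hcorr]
      have b₁ := abs_le.1 (h₁.feasible j)
      have b₂ := abs_le.1 (h₂.feasible j)
      rw [abs_le]
      constructor <;> nlinarith
    · have hα' : 0 ≤ α / τ₁ := by positivity
      have hβ' : 0 ≤ β / τ₂ := by positivity
      rw [hcorr]
      simp only [Pi.smul_apply, Pi.add_apply, smul_eq_mul]
      by_cases hj : |(Aᵀ *ᵥ p₁) j| = 1
      · have c₁ := h₁.complementary j
        have c₂ := h₂.complementary j
        rw [eq_of_facePattern_eq hface hj] at c₂ ⊢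
        rcases (abs_eq zero_le_one).1 hj with h1 | h1
        · rw [h1] at c₁ c₂ ⊢
          have n₁ := abs_nonneg (x₁ j)
          have n₂ := abs_nonneg (x₂ j)
          have m₁ : 0 ≤ α / τ₁ * -x₁ j := mul_nonneg hα' (by linarith)
          have m₂ : 0 ≤ β / τ₂ * -x₂ j := mul_nonneg hβ' (by linarith)
          rw [abs_of_nonpos (mul_nonpos_of_nonneg_of_nonpos hτ.le (by linarith)),
            mul_one, mul_one, hαβ, one_mul]
        · rw [h1] at c₁ c₂ ⊢
          have n₁ := abs_nonneg (x₁ j)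
          have n₂ := abs_nonneg (x₂ j)
          have m₁ : 0 ≤ α / τ₁ * x₁ j := mul_nonneg hα' (by linarith)
          have m₂ : 0 ≤ β / τ₂ * x₂ j := mul_nonneg hβ' (by linarith)
          rw [abs_of_nonneg (mul_nonneg hτ.le (by linarith)),
            mul_neg_one, mul_neg_one, ← neg_add, hαβ]
          ring
      · have z₁ : x₁ j = 0 := by
          by_contra hc
          exact hj (h₁.abs_eq_one_of_ne_zero hc)
        have z₂ : x₂ j = 0 := by
          by_contra hc
          exact hj ((abs_eq_one_iff_of_facePattern_eq hface j).2 (h₂.abs_eq_one_of_ne_zero hc))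
        simp [z₁, z₂]
  rw [h.dual_unique hτ hkkt, facePattern_eq_iff]
  intro j
  rw [hcorr]
  by_cases hj : |(Aᵀ *ᵥ p₁) j| = 1
  · rw [eq_of_facePattern_eq hface hj, ← add_mul, hαβ, one_mul]
    simp
  · -- A convex combination of correlations in `(-1, 1)` stays in `(-1, 1)`.
    have hj₂ := fun hc => hj ((abs_eq_one_iff_of_facePattern_eq hface j).2 hc)
    have s₁ := abs_lt.1 (lt_of_le_of_ne (h₁.feasible j) hj)
    have s₂ := abs_lt.1 (lt_of_le_of_ne (h₂.feasible j) hj₂)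
    have s : α * (Aᵀ *ᵥ p₁) j + β * (Aᵀ *ᵥ p₂) j ∈ Set.Ioo (-1 : ℝ) 1 :=
      (convex_Ioo (-1 : ℝ) 1) s₁ s₂ hα hβ hαβ
    exact ⟨iff_of_false s.2.ne s₁.2.ne, iff_of_false s.1.ne' s₁.1.ne'⟩

/-! ### The interior of a linear piece -/

/-- The midpoint of the interval of hyperparameters covered by an iteration. -/
noncomputable def midT (A : Matrix (Fin m) (Fin n) ℝ) (s : State m n) : ℝ :=
  (nextT A s + s.t) / 2

/-- The dual vector at the midpoint of an iteration. -/
noncomputable def midDual (A : Matrix (Fin m) (Fin n) ℝ) (s : State m n) : Fin m → ℝ :=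
  s.p + (1 / midT A s - 1 / s.t) • xi A s

/-- The velocity of the primal path as the hyperparameter decreases. -/
noncomputable def velocity (A : Matrix (Fin m) (Fin n) ℝ) (s : State m n) : Fin n → ℝ :=
  (1 / s.t) • (signMatrix A s.p *ᵥ vHat A s)

/-- An admissible state: the hyperparameter is positive and the optimality conditions hold. -/
structure Admissible (A : Matrix (Fin m) (Fin n) ℝ) (b : Fin m → ℝ) (s : State m n) : Prop where
  pos : 0 < s.t
  kkt : KKT A b s.t s.x s.p

namespace Admissible

lemma nextT_lt_midT (h : Admissible A b s) : nextT A s < midT A s := by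
  have := (nextT_spec h.pos h.kkt.feasible).2.1
  unfold midT
  linarith

lemma midT_lt (h : Admissible A b s) : midT A s < s.t := by
  have := (nextT_spec h.pos h.kkt.feasible).2.1
  unfold midT
  linarith

lemma midT_pos (h : Admissible A b s) : 0 < midT A s :=
  (nextT_spec h.pos h.kkt.feasible).1.trans_lt h.nextT_lt_midT

lemma kkt_mid (h : Admissible A b s) :
    KKT A b (midT A s) (primalPath A s (midT A s)) (midDual A s) :=
  h.kkt.path_of_pos h.pos h.midT_pos h.nextT_lt_midT.le h.midT_lt.le

/-- A dual constraint is active inside a linear piece exactly if it is active at its start and its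
correlation is constant along the piece. -/
lemma abs_midDual_eq_one_iff (h : Admissible A b s) (j : Fin n) :
    |(Aᵀ *ᵥ midDual A s) j| = 1 ↔ |(Aᵀ *ᵥ s.p) j| = 1 ∧ corrRate A s j = 0 := by
  rw [midDual, abs_transpose_mulVec_add_smul]
  have hm0 := h.midT_pos
  have hm1 := h.midT_lt
  have hmN := h.nextT_lt_midT
  have hN0 := (nextT_spec h.pos h.kkt.feasible).1
  -- The bounds hold up to a hyperparameter `τ` beyond the midpoint, so they are strict there.
  obtain ⟨τ, hτN, hτm⟩ := exists_between hmN
  have hτ0 := hN0.trans_lt hτN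
  have hb := mul_corrRate_bounds h.pos h.kkt.feasible hτ0 hτN.le (hτm.le.trans hm1.le) j
  have hc0 : 0 < 1 / midT A s - 1 / s.t := sub_pos.2 (one_div_lt_one_div_of_lt hm0 hm1)
  have hcc : 1 / midT A s - 1 / s.t < 1 / τ - 1 / s.t := by
    have := one_div_lt_one_div_of_lt hτ0 hτm
    linarith
  set c := 1 / midT A s - 1 / s.t
  set c' := 1 / τ - 1 / s.t
  have ha := h.kkt.feasible j
  have ha0 := abs_nonneg ((Aᵀ *ᵥ s.p) j)
  constructor
  · intro h1
    have hq : corrRate A s j = 0 := by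
      by_contra hq
      have : |-|(Aᵀ *ᵥ s.p) j| + c * corrRate A s j| < 1 := by
        rw [abs_lt]
        rcases lt_or_gt_of_ne hq with hq | hq
        · have hlt : c' * corrRate A s j < c * corrRate A s j := mul_lt_mul_of_neg_right hcc hq
          have hneg : c * corrRate A s j < 0 := mul_neg_of_pos_of_neg hc0 hq
          constructor <;> linarith
        · have hlt : c * corrRate A s j < c' * corrRate A s j := mul_lt_mul_of_pos_right hcc hq
          have hpos : 0 < c * corrRate A s j := mul_pos hc0 hq
          constructor <;> linarith
      exact this.ne h1
    refine ⟨?_, hq⟩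
    rwa [hq, mul_zero, add_zero, abs_neg, abs_abs] at h1
  · rintro ⟨h1, h2⟩
    rw [h2, mul_zero, add_zero, abs_neg, abs_abs, h1]

lemma transpose_mulVec_xi_eq_zero (h : Admissible A b s) {j : Fin n}
    (hj : |(Aᵀ *ᵥ midDual A s) j| = 1) : (Aᵀ *ᵥ xi A s) j = 0 := by
  have hq := ((h.abs_midDual_eq_one_iff j).1 hj).2
  rw [corrRate_apply] at hq
  refine (mul_eq_zero.1 hq).resolve_left fun h0 => ?_
  simpa [h0] using abs_sgn (-(Aᵀ *ᵥ s.p) j)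

lemma transpose_mulVec_midDual (h : Admissible A b s) {j : Fin n}
    (hj : |(Aᵀ *ᵥ midDual A s) j| = 1) : (Aᵀ *ᵥ midDual A s) j = (Aᵀ *ᵥ s.p) j := by
  have hq := h.transpose_mulVec_xi_eq_zero hj
  simp [midDual, Matrix.mulVec_add, Matrix.mulVec_smul, hq]

lemma mulVec_velocity (h : Admissible A b s) :
    A *ᵥ velocity A s = (1 / midT A s) • xi A s - midDual A s := by
  have hv : A *ᵥ (signMatrix A s.p *ᵥ vHat A s) = xi A s - s.t • s.p := by
    rw [xi, residual, Matrix.mulVec_mulVec]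
    module
  rw [velocity, Matrix.mulVec_smul, hv, midDual, smul_sub, smul_smul,
    one_div_mul_cancel h.pos.ne']
  module

lemma velocity_eq_zero (h : Admissible A b s) {j : Fin n}
    (hj : |(Aᵀ *ᵥ midDual A s) j| ≠ 1) : velocity A s j = 0 := by
  have hv : vHat A s j = 0 := by
    by_contra hv
    refine hj ((h.abs_midDual_eq_one_iff j).2 ⟨?_, corrRate_eq_zero_of_vHat_ne_zero hv⟩)
    by_contra hc
    exact hv (vHat_eq_zero hc)
  rw [velocity, Pi.smul_apply, signMatrix_mulVec_apply, hv]
  simp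

lemma mul_velocity (h : Admissible A b s) {j : Fin n}
    (hj : |(Aᵀ *ᵥ midDual A s) j| = 1) :
    (Aᵀ *ᵥ midDual A s) j * velocity A s j = -(vHat A s j / s.t) := by
  have ha := ((h.abs_midDual_eq_one_iff j).1 hj).1
  rw [h.transpose_mulVec_midDual hj, velocity, Pi.smul_apply, signMatrix_mulVec_apply,
    smul_eq_mul, mul_left_comm, ← mul_assoc ((Aᵀ *ᵥ s.p) j), mul_comm ((Aᵀ *ᵥ s.p) j),
    sgn_neg_mul, ha]
  ring

lemma mul_velocity_nonpos (h : Admissible A b s) {j : Fin n}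
    (hj : |(Aᵀ *ᵥ midDual A s) j| = 1) (hx : s.x j = 0) :
    (Aᵀ *ᵥ midDual A s) j * velocity A s j ≤ 0 := by
  rw [h.mul_velocity hj, neg_nonpos]
  exact div_nonneg (vHat_nonneg hx) h.pos.le

/-- The velocity has the least norm among the admissible velocities producing the same change of
the residual. -/
lemma sqNorm_velocity_le (h : Admissible A b s) {g : Fin n → ℝ}
    (hA : A *ᵥ g = A *ᵥ velocity A s)
    (hsupp : ∀ j, |(Aᵀ *ᵥ midDual A s) j| ≠ 1 → g j = 0)
    (hsign : ∀ j, |(Aᵀ *ᵥ midDual A s) j| = 1 → s.x j = 0 → (Aᵀ *ᵥ midDual A s) j * g j ≤ 0) :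
    sqNorm (velocity A s) ≤ sqNorm g := by
  set w := s.t • (signMatrix A s.p *ᵥ g) with hw
  have hwj : ∀ j, w j = s.t * (sgn (-(Aᵀ *ᵥ s.p) j) * g j) := fun j => by
    rw [hw, Pi.smul_apply, signMatrix_mulVec_apply, smul_eq_mul]
  have hres : residual A s w = xi A s := by
    have h1 : (A * signMatrix A s.p) *ᵥ w = s.t • (A *ᵥ g) := by
      rw [hw, ← Matrix.mulVec_mulVec, Matrix.mulVec_smul, Matrix.mulVec_smul,
        signMatrix_mulVec_mulVec]
    rw [xi, residual, residual, h1, hA, velocity, Matrix.mulVec_smul, Matrix.mulVec_mulVec,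
      smul_smul, mul_one_div_cancel h.pos.ne', one_smul]
  have hfeas : NNLSFeasible A s w := by
    refine ⟨fun j hj hx => ?_, fun j hj => ?_⟩
    · rw [hwj]
      by_cases hm : |(Aᵀ *ᵥ midDual A s) j| = 1
      · have h1 := hsign j hm hx
        have h2 := (mem_equicorrelationSet_iff A s.p j).1 hj
        rw [h.transpose_mulVec_midDual hm] at h1
        have h3 : sgn (-(Aᵀ *ᵥ s.p) j) = -(Aᵀ *ᵥ s.p) j := by
          rcases (abs_eq zero_le_one).1 h2 with h4 | h4
          · rw [h4, sgn, if_neg (by norm_num)]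
          · rw [h4, sgn, if_pos (by norm_num)]
            norm_num
        rw [h3]
        exact mul_nonneg h.pos.le (by linarith)
      · simp [hsupp j hm]
    · have hm : |(Aᵀ *ᵥ midDual A s) j| ≠ 1 := fun hm =>
        hj ((mem_equicorrelationSet_iff A s.p j).2 ((h.abs_midDual_eq_one_iff j).1 hm).1)
      rw [hwj, hsupp j hm]
      simp
  have hle := (vHat_spec A s).2 w
    ⟨hfeas, fun z hz => by rw [hres]; exact (vHat_spec A s).1.2 z hz⟩
  rw [hw, sqNorm_smul, sqNorm_signMatrix_mulVec] at hle
  rw [velocity, sqNorm_smul, sqNorm_signMatrix_mulVec, one_div, inv_pow,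
    inv_mul_le_iff₀ (pow_pos h.pos 2)]
  exact hle

end Admissible

/-! ### Termination -/

/-- Normal equations on a support have at most one fitted value. -/
lemma mulVec_eq_zero_of_supported {E : Set (Fin n)} {h : Fin n → ℝ} (hE : ∀ j ∉ E, h j = 0)
    (hn : ∀ j ∈ E, (Aᵀ *ᵥ (A *ᵥ h)) j = 0) : A *ᵥ h = 0 := by
  rw [← sqNorm_eq_zero, sqNorm_eq_dotProduct, ← transpose_mulVec_dotProduct]
  refine Finset.sum_eq_zero fun j _ => ?_
  by_cases hj : j ∈ E
  · rw [hn j hj, zero_mul]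
  · rw [hE j hj, mul_zero]

namespace Admissible

variable {s' : State m n}

/-- The face determines the image of the velocity. -/
lemma mulVec_velocity_eq (h : Admissible A b s) (h' : Admissible A b s')
    (hface : facePattern A (midDual A s) = facePattern A (midDual A s')) :
    A *ᵥ velocity A s' = A *ᵥ velocity A s := by
  rw [← sub_eq_zero, ← Matrix.mulVec_sub]
  have hiff := abs_eq_one_iff_of_facePattern_eq hface
  refine mulVec_eq_zero_of_supported (E := {j | |(Aᵀ *ᵥ midDual A s) j| = 1})
    (fun j hj => ?_) fun j hj => ?_
  · have hj' : |(Aᵀ *ᵥ midDual A s') j| ≠ 1 := fun hc => hj ((hiff j).2 hc)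
    rw [Pi.sub_apply, h.velocity_eq_zero hj, h'.velocity_eq_zero hj', sub_zero]
  · have hj' := (hiff j).1 hj
    rw [Matrix.mulVec_sub, h.mulVec_velocity, h'.mulVec_velocity]
    simp only [Matrix.mulVec_sub, Matrix.mulVec_smul, Pi.sub_apply, Pi.smul_apply]
    rw [h.transpose_mulVec_xi_eq_zero hj, h'.transpose_mulVec_xi_eq_zero hj',
      eq_of_facePattern_eq hface hj]
    simp

/-- The face determines the velocity of the dual path in the parameter `1 / τ`. -/
lemma xi_eq (h : Admissible A b s) (h' : Admissible A b s')
    (hface : facePattern A (midDual A s) = facePattern A (midDual A s')) : xi A s' = xi A s := by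
  have hiff := abs_eq_one_iff_of_facePattern_eq hface
  have key : ∀ {r : State m n}, Admissible A b r →
      xi A r = A *ᵥ (midT A r • velocity A r + primalPath A r (midT A r)) - b := by
    intro r hr
    rw [Matrix.mulVec_add, Matrix.mulVec_smul, hr.mulVec_velocity, add_sub_assoc,
      ← hr.kkt_mid.stationary, smul_sub, smul_smul, mul_one_div_cancel hr.midT_pos.ne']
    module
  have hsupp : ∀ {r : State m n}, Admissible A b r → ∀ j, |(Aᵀ *ᵥ midDual A r) j| ≠ 1 →
      (midT A r • velocity A r + primalPath A r (midT A r)) j = 0 := by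
    intro r hr j hj
    have hx : primalPath A r (midT A r) j = 0 := by
      by_contra hc
      exact hj (hr.kkt_mid.abs_eq_one_of_ne_zero hc)
    simp [hr.velocity_eq_zero hj, hx]
  have hdiff : xi A s' - xi A s = A *ᵥ ((midT A s' • velocity A s' + primalPath A s' (midT A s')) -
      (midT A s • velocity A s + primalPath A s (midT A s))) := by
    rw [key h, key h', Matrix.mulVec_sub]
    module
  rw [← sub_eq_zero, hdiff]
  refine mulVec_eq_zero_of_supported (E := {j | |(Aᵀ *ᵥ midDual A s) j| = 1})
    (fun j hj => ?_) fun j hj => ?_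
  · have hj' : |(Aᵀ *ᵥ midDual A s') j| ≠ 1 := fun hc => hj ((hiff j).2 hc)
    rw [Pi.sub_apply, hsupp h j hj, hsupp h' j hj', sub_zero]
  · rw [← hdiff, Matrix.mulVec_sub, Pi.sub_apply, h.transpose_mulVec_xi_eq_zero hj,
      h'.transpose_mulVec_xi_eq_zero ((hiff j).1 hj), sub_zero]

/-- The velocity has the least norm even if only the constraints at indices where both the primal
vector and the velocity vanish are kept: a strict inequality constraint does not matter to a
minimizer of a convex function. -/
lemma velocity_dotProduct_sub_nonneg (h : Admissible A b s) {g : Fin n → ℝ}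
    (hA : A *ᵥ g = A *ᵥ velocity A s)
    (hsupp : ∀ j, |(Aᵀ *ᵥ midDual A s) j| ≠ 1 → g j = 0)
    (hsign : ∀ j, |(Aᵀ *ᵥ midDual A s) j| = 1 → s.x j = 0 → velocity A s j = 0 →
      (Aᵀ *ᵥ midDual A s) j * g j ≤ 0) :
    0 ≤ velocity A s ⬝ᵥ (g - velocity A s) := by
  set u := velocity A s with hu
  have hfeas : ∀ᶠ ε : ℝ in 𝓝[>] 0, ∀ j, |(Aᵀ *ᵥ midDual A s) j| = 1 → s.x j = 0 →
      (Aᵀ *ᵥ midDual A s) j * (u + ε • (g - u)) j ≤ 0 := by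
    rw [Filter.eventually_all]
    intro j
    by_cases hj : |(Aᵀ *ᵥ midDual A s) j| = 1 ∧ s.x j = 0
    swap
    · exact Filter.Eventually.of_forall fun ε h1 h2 => absurd ⟨h1, h2⟩ hj
    by_cases hu0 : u j = 0
    · have h1 := hsign j hj.1 hj.2 hu0
      filter_upwards [self_mem_nhdsWithin] with ε hε _ _
      have hε' : 0 < ε := hε
      simp only [Pi.add_apply, Pi.smul_apply, Pi.sub_apply, smul_eq_mul, hu0, zero_add, sub_zero]
      rw [mul_left_comm]
      exact mul_nonpos_of_nonneg_of_nonpos hε'.le h1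
    · have hne : (Aᵀ *ᵥ midDual A s) j ≠ 0 := fun h0 => by simp [h0] at hj
      have hlt : (Aᵀ *ᵥ midDual A s) j * u j < 0 :=
        lt_of_le_of_ne (h.mul_velocity_nonpos hj.1 hj.2) (mul_ne_zero hne hu0)
      have hcont : Continuous fun ε : ℝ => (Aᵀ *ᵥ midDual A s) j * (u + ε • (g - u)) j := by
        simp only [Pi.add_apply, Pi.smul_apply, Pi.sub_apply, smul_eq_mul]
        fun_prop
      have hev := (hcont.tendsto 0).eventually_lt_const (u := 0) (by simpa using hlt)
      exact (hev.filter_mono nhdsWithin_le_nhds).mono fun ε hε _ _ => hε.le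
  have hev : ∀ᶠ ε : ℝ in 𝓝[>] 0, 0 ≤ 2 * (u ⬝ᵥ (g - u)) + ε * sqNorm (g - u) := by
    filter_upwards [hfeas, self_mem_nhdsWithin] with ε hε hε0
    have hε0' : 0 < ε := hε0
    have hle : sqNorm u ≤ sqNorm (u + ε • (g - u)) := by
      refine h.sqNorm_velocity_le ?_ (fun j hj => ?_) hε
      · rw [Matrix.mulVec_add, Matrix.mulVec_smul, Matrix.mulVec_sub, hA, sub_self, smul_zero,
          add_zero]
      · have hu0 : u j = 0 := h.velocity_eq_zero hj
        simp [hu0, hsupp j hj]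
    rw [sqNorm_add, dotProduct_smul, sqNorm_smul, smul_eq_mul] at hle
    refine nonneg_of_mul_nonneg_right (a := ε) ?_ hε0'
    nlinarith
  have hlim : Filter.Tendsto (fun ε : ℝ => 2 * (u ⬝ᵥ (g - u)) + ε * sqNorm (g - u)) (𝓝[>] 0)
      (𝓝 (2 * (u ⬝ᵥ (g - u)) + 0 * sqNorm (g - u))) :=
    (Continuous.tendsto (by fun_prop) 0).mono_left nhdsWithin_le_nhds
  have := ge_of_tendsto hlim hev
  linarith

/-- While the dual path stays in one face, the norm of the velocity increases strictly: a new
sign constraint is violated by the old velocity, and the constraints that were dropped did not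
matter. -/
lemma sqNorm_velocity_lt_step (h : Admissible A b s) (h' : Admissible A b (step A s))
    (hface : facePattern A (midDual A s) = facePattern A (midDual A (step A s))) :
    sqNorm (velocity A s) < sqNorm (velocity A (step A s)) := by
  have hiff := abs_eq_one_iff_of_facePattern_eq hface
  have hst : step A s = ⟨nextT A s, primalPath A s (nextT A s), dualPath A s (nextT A s)⟩ := by
    rw [step, if_neg h.pos.ne']
  have ht' : (step A s).t = nextT A s := by rw [hst]
  have hx' : (step A s).x = primalPath A s (nextT A s) := by rw [hst]
  have hN : 0 < nextT A s := ht' ▸ h'.pos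
  have hp' : (step A s).p = s.p + (1 / nextT A s - 1 / s.t) • xi A s := by
    rw [hst]
    simp only [dualPath, if_neg hN.ne']
  have hAg := h.mulVec_velocity_eq h' hface
  have hxi := h.xi_eq h' hface
  set g := velocity A (step A s) with hg
  have hdot : 0 ≤ velocity A s ⬝ᵥ (g - velocity A s) := by
    refine h.velocity_dotProduct_sub_nonneg hAg
      (fun j hj => h'.velocity_eq_zero fun hc => hj ((hiff j).2 hc)) fun j hj hx hv => ?_
    rw [← eq_of_facePattern_eq hface hj]
    refine h'.mul_velocity_nonpos ((hiff j).1 hj) ?_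
    have hv0 : (signMatrix A s.p *ᵥ vHat A s) j = 0 := by
      rw [velocity, Pi.smul_apply, smul_eq_mul] at hv
      exact (mul_eq_zero.1 hv).resolve_left (one_div_pos.2 h.pos).ne'
    rw [hx', primalPath, Pi.add_apply, Pi.smul_apply, hx, hv0, smul_zero, add_zero]
  have hne : g - velocity A s ≠ 0 := by
    intro h0
    have hgv : g = velocity A s := sub_eq_zero.1 h0
    rcases (nextT_spec h.pos h.kkt.feasible).2.2.2.2.2 hN with ⟨j, hx, hv, hj⟩ | ⟨j, hq, hj⟩
    · -- The coordinate that has just vanished cannot continue in the same direction.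
      have hm : |(Aᵀ *ᵥ midDual A s) j| = 1 := (h.abs_midDual_eq_one_iff j).2
        ⟨h.kkt.abs_eq_one_of_ne_zero hx, corrRate_eq_zero (h.kkt.abs_eq_one_of_ne_zero hx) hx⟩
      have hxj : (step A s).x j = 0 := by
        rw [hx', h.kkt.primalPath_apply, hj, mul_zero]
      have h1 := h'.mul_velocity_nonpos ((hiff j).1 hm) hxj
      rw [← hg, hgv, eq_of_facePattern_eq hface hm, h.mul_velocity hm] at h1
      have h2 : vHat A s j / s.t < 0 := div_neg_of_neg_of_pos hv h.pos
      linarith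
    · -- The dual constraint that has just become active would be violated by the same `ξ`.
      have hf := h'.kkt_mid.feasible j
      have hc' : 0 < 1 / midT A (step A s) - 1 / (step A s).t :=
        sub_pos.2 (one_div_lt_one_div_of_lt h'.midT_pos h'.midT_lt)
      rw [midDual, hxi, hp', add_assoc, ← add_smul, abs_transpose_mulVec_add_smul, add_mul,
        hj] at hf
      set c' := 1 / midT A (step A s) - 1 / (step A s).t
      rw [abs_le] at hf
      rcases lt_or_gt_of_ne hq with hq | hq
      · rw [sgn, if_neg (not_le.2 hq)] at hf
        have := mul_neg_of_pos_of_neg hc' hq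
        linarith [hf.1]
      · rw [sgn, if_pos hq.le] at hf
        have := mul_pos hc' hq
        linarith [hf.2]
  have hpos : 0 < sqNorm (g - velocity A s) :=
    lt_of_le_of_ne (sqNorm_nonneg _) fun h0 => hne (sqNorm_eq_zero.1 h0.symm)
  have hexp : sqNorm g = sqNorm (velocity A s) +
      2 * (velocity A s ⬝ᵥ (g - velocity A s)) + sqNorm (g - velocity A s) := by
    rw [← sqNorm_add]
    congr 1
    module
  rw [hexp]
  linarith

/-- The norm of the velocity is a function of the face and of the zero set of the primal
vector. -/
lemma sqNorm_velocity_le_of_eq (h : Admissible A b s) (h' : Admissible A b s')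
    (hface : facePattern A (midDual A s) = facePattern A (midDual A s'))
    (hzero : {j | s.x j = 0} = {j | s'.x j = 0}) :
    sqNorm (velocity A s) ≤ sqNorm (velocity A s') := by
  have hiff := abs_eq_one_iff_of_facePattern_eq hface
  refine h.sqNorm_velocity_le (h.mulVec_velocity_eq h' hface)
    (fun j hj => h'.velocity_eq_zero fun hc => hj ((hiff j).2 hc)) fun j hj hx => ?_
  rw [← eq_of_facePattern_eq hface hj]
  exact h'.mul_velocity_nonpos ((hiff j).1 hj) (hzero.subset hx)

end Admissible

lemma exists_iterate_t_eq_zero (hA : A.rank = m) (hb : b ≠ 0) :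
    ∃ k, (iterate A b k).t = 0 := by
  by_contra! hne
  have hadm : ∀ k, Admissible A b (iterate A b k) := fun k => by
    obtain ⟨h0, h1⟩ := KKT.iterate hA hb (k := k) fun i _ => hne i
    exact ⟨lt_of_le_of_ne h0 (hne k).symm, h1⟩
  have hnext : ∀ k, (iterate A b (k + 1)).t = nextT A (iterate A b k) := fun k => by
    rw [iterate, step, if_neg (hne k)]
  have hanti : StrictAnti fun k => midT A (iterate A b k) := by
    refine strictAnti_nat_of_succ_lt fun k => ?_
    have h1 := (hadm (k + 1)).midT_lt
    rw [hnext] at h1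
    exact h1.trans (hadm k).nextT_lt_midT
  -- Some face and zero set of the primal vector occur at two iterations.
  obtain ⟨k, l, hkl, heq⟩ := Finite.exists_ne_map_eq_of_infinite fun k =>
    (facePattern A (midDual A (iterate A b k)), {j | (iterate A b k).x j = 0})
  wlog hlt : k < l generalizing k l
  · exact this l k hkl.symm heq.symm (lt_of_le_of_ne (not_lt.1 hlt) hkl.symm)
  obtain ⟨hface, hzero⟩ := Prod.mk.inj heq
  have hbetween : ∀ i, k ≤ i → i ≤ l → facePattern A (midDual A (iterate A b i)) =
      facePattern A (midDual A (iterate A b k)) := fun i hki hil =>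
    (hadm k).kkt_mid.facePattern_eq_of_between (hadm l).kkt_mid (hadm i).kkt_mid hface
      (hadm l).midT_pos (hanti.antitone hil) (hanti.antitone hki)
  have hmono : ∀ i, k < i → i ≤ l →
      sqNorm (velocity A (iterate A b k)) < sqNorm (velocity A (iterate A b i)) := by
    intro i hki
    induction i, hki using Nat.le_induction with
    | base =>
      intro hl
      exact (hadm k).sqNorm_velocity_lt_step (hadm (k + 1)) (hbetween (k + 1) (by omega) hl).symm
    | succ i hi ih =>
      intro hl
      refine (ih (by omega)).trans ((hadm i).sqNorm_velocity_lt_step (hadm (i + 1)) ?_)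
      exact (hbetween i (by omega) (by omega)).trans (hbetween (i + 1) (by omega) hl).symm
  exact (hmono l hlt le_rfl).not_ge
    ((hadm l).sqNorm_velocity_le_of_eq (hadm k) hface.symm hzero.symm)

end BPDN

theorem mainTheorem5 {m n : ℕ} (A : Matrix (Fin m) (Fin n) ℝ) (hA : A.rank = m)
    (b : Fin m → ℝ) (hb : b ≠ 0) :
    ∃ K : ℕ,
      -- finite termination
      (BPDN.iterate A b K).t = 0 ∧
      -- every iterate is a pair of primal and dual solutions at its hyperparameter
      (∀ k ≤ K,
        BPDN.IsPrimalSolution A b (BPDN.iterate A b k).t (BPDN.iterate A b k).x ∧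
        BPDN.IsDualSolution A b (BPDN.iterate A b k).t (BPDN.iterate A b k).p) ∧
      -- every iteration is well defined, lowers the hyperparameter, and continues the solutions
      -- over the whole interval between two consecutive hyperparameters
      ∀ k < K,
        (∃! v : Fin n → ℝ, BPDN.IsMinNormNNLSSolution A (BPDN.iterate A b k) v) ∧
        0 ≤ (BPDN.iterate A b (k + 1)).t ∧
        (BPDN.iterate A b (k + 1)).t < (BPDN.iterate A b k).t ∧
        ∀ τ ∈ Set.Icc (BPDN.iterate A b (k + 1)).t (BPDN.iterate A b k).t,
          BPDN.IsPrimalSolution A b τ (BPDN.primalPath A (BPDN.iterate A b k) τ) ∧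
          BPDN.IsDualSolution A b τ (BPDN.dualPath A (BPDN.iterate A b k) τ) := by
  classical
  have hex := BPDN.exists_iterate_t_eq_zero hA hb
  -- The first index at which the hyperparameter vanishes: before it every state is admissible.
  have hkkt : ∀ k ≤ Nat.find hex, 0 ≤ (BPDN.iterate A b k).t ∧
      BPDN.KKT A b (BPDN.iterate A b k).t (BPDN.iterate A b k).x (BPDN.iterate A b k).p :=
    fun k hk => BPDN.KKT.iterate hA hb fun i hi => Nat.find_min hex (hi.trans_le hk)
  refine ⟨Nat.find hex, Nat.find_spec hex, fun k hk => ?_, fun k hk => ?_⟩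
  · obtain ⟨h0, h1⟩ := hkkt k hk
    exact ⟨h1.isPrimalSolution h0, h1.isDualSolution h0⟩
  · obtain ⟨h0, h1⟩ := hkkt k hk.le
    have hne := Nat.find_min hex hk
    have hpos : 0 < (BPDN.iterate A b k).t := lt_of_le_of_ne h0 (Ne.symm hne)
    have hnext : (BPDN.iterate A b (k + 1)).t = BPDN.nextT A (BPDN.iterate A b k) := by
      rw [BPDN.iterate, BPDN.step, if_neg hne]
    have hspec := BPDN.nextT_spec hpos h1.feasible
    rw [hnext]
    refine ⟨BPDN.existsUnique_isMinNormNNLSSolution A _, hspec.1, hspec.2.1, fun τ hτ => ?_⟩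
    have hpath := h1.path_dualPath hA hpos hτ.1 hτ.2
    exact ⟨hpath.isPrimalSolution (hspec.1.trans hτ.1),
      hpath.isDualSolution (hspec.1.trans hτ.1)⟩
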